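/- For a finite simple graph $G$ and a vertex $v$ of $G$, let $d(v)$ be the degree of $v$, let $\omega(v)$ be the size of the largest clique of $G$ containing $v$, and let $\Delta(G)$ be the maximum degree of $G$. Given a finite list $L(v)$ of colors for each vertex $v$, the graph $G$ is $L$-colorable if one can choose a color $\phi(v)\in L(v)$ for every vertex $v$ so that $\phi(u)\neq\phi(v)$ whenever $u$ and $v$ are adjacent. Let $\varepsilon = \frac{1}{330}$, and let $\log$ be the natural logarithm. (a) There exists $\Delta_0$ such that the following holds. If $G$ is a finite simple graph with $\Delta(G)\geq\Delta_0$ and $L$ is a list-assignment for $G$ such that for every $v\in V(G)$, $$|L(v)| \geq \omega(v) + (\log \Delta(G))^{10} \quad\text{and}\quad |L(v)| \geq (1-\varepsilon)(d(v)+1) + \varepsilon\,\omega(v),$$ then $G$ is $L$-colorable. (b) (Inductive form.) There exists $\Delta_0$ such that for every integer $\Delta\geq\Delta_0$ the following holds. If $G$ is a finite simple graph with maximum degree at most $\Delta$ and $L$ is a list-assignment for $G$ such that for every $v\in V(G)$, $$|L(v)| \geq \omega(v) + (\log \Delta)^{10} \quad\text{and}\quad |L(v)| \geq (1-\varepsilon)(d(v)+1)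 + \varepsilon\,\omega(v),$$ then $G$ is $L$-colorable. -/

import Mathlib

namespace SimpleGraph

/-- `ω(v)`: the size of the largest clique of `G` containing the vertex `v`. -/
noncomputable def cliqueNumAt {V : Type*} (G : SimpleGraph V) (v : V) : ℕ :=
  sSup {n | ∃ s : Finset V, G.IsNClique n s ∧ v ∈ s}

/-- On a finite graph the supremum defining `ω(v)` is a maximum. -/
theorem isGreatest_cliqueNumAt {V : Type*} [Finite V] (G : SimpleGraph V) (v : V) :
    IsGreatest {n | ∃ s : Finset V, G.IsNClique n s ∧ v ∈ s} (G.cliqueNumAt v) := by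
  have := Fintype.ofFinite V
  have hbdd : BddAbove {n | ∃ s : Finset V, G.IsNClique n s ∧ v ∈ s} := by
    refine ⟨Fintype.card V, ?_⟩
    rintro n ⟨s, hs, -⟩
    exact hs.card_eq ▸ s.card_le_univ
  have hne : {n | ∃ s : Finset V, G.IsNClique n s ∧ v ∈ s}.Nonempty :=
    ⟨1, {v}, by simp [isNClique_iff], by simp⟩
  exact ⟨Nat.sSup_mem hne hbdd, fun n hn => le_csSup hbdd hn⟩

/-- `G` is `L`-colorable: there is a proper coloring of `G` in which every vertex `v`
receives a color from its list `L v`. -/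
def ListColorable {V C : Type*} (G : SimpleGraph V) (L : V → Finset C) : Prop :=
  ∃ φ : G.Coloring C, ∀ v, φ v ∈ L v

end SimpleGraph

/-! By induction on the number of vertices it suffices to exclude a list-critical graph, that is, a
minimal counterexample: with `Δ` and the additive term fixed, passing to an induced subgraph
preserves the hypotheses. A critical graph satisfies |L(v)| ≤ d(v), so gap(v) = d(v) + 1 − ω(v) is
at least the additive term, while save(v) = d(v) + 1 − |L(v)|, the number of colors that v must
save, is at most gap(v)/330.

Color at random: each vertex stays blank with probability 1/2 and otherwise takes a uniform color of
its list, which it keeps unless a neighbor with a list at least as long took the same color. The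
remaining vertices are colored greedily in order of decreasing list size. This succeeds at v as soon
as save(v) units are saved (`isGood_of_le`): by neighbors with shorter lists that stay blank, by
neighbors that keep a color outside L(v), or by a color of L(v) kept at two neighbors.

Criticality makes one of these sources plentiful (`IsListCritical.saving_cases`). If few neighbors
have shorter lists and the lists of the others lie mostly inside L(v), then the neighborhood must
contain at least 0.15 · gap(v) · d(v) ordered nonadjacent pairs. Otherwise a dense part H of it has
a large matching in its complement, and Hall's theorem extends a coloring of G − H to H
(`exists_coloring_of_antimatching`), contradicting criticality.

In each case the expected savings exceed save(v) by a margin. Talagrand's convex distance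
inequality, applied to a difference of two certifiable counts (`prob_sub_le_expect_sub`), makes
failure at v exponentially unlikely in the additive term. Failure depends only on the ball of radius
two, so for log(Δ)^10 and large Δ the local lemma (`exists_avoiding`) avoids all failures at once.
-/

set_option linter.unusedSectionVars false

/-! ### Finite product probability and the Lovász local lemma. -/

namespace FiniteProduct

variable {ι β : Type*} [Fintype ι] [Fintype β]

/-- A family of probability weights on `β`, indexed by `ι`. -/
structure IsWeight (w : ι → β → ℝ) : Prop where
  nonneg : ∀ i b, 0 ≤ w i b
  sum_eq_one : ∀ i, ∑ b, w i b = 1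

/-- The weight of a point of the product space. -/
def weight (w : ι → β → ℝ) (a : ι → β) : ℝ := ∏ i, w i (a i)

theorem weight_nonneg {w : ι → β → ℝ} (hw : IsWeight w) (a : ι → β) : 0 ≤ weight w a :=
  Finset.prod_nonneg fun i _ => hw.nonneg i (a i)

variable [DecidableEq ι]

/-- Expectation of `F` under the product of the weights `w i`. -/
def expect (w : ι → β → ℝ) (F : (ι → β) → ℝ) : ℝ := ∑ a, weight w a * F a

open Classical in
/-- Probability of `A` under the product of the weights `w i`. -/
noncomputable def prob (w : ι → β → ℝ) (A : Set (ι → β)) : ℝ :=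
  expect w (fun a => if a ∈ A then 1 else 0)

variable {w : ι → β → ℝ}

theorem sum_weight (hw : IsWeight w) : ∑ a, weight w a = 1 := by
  have h := Finset.prod_univ_sum (fun _ : ι => (Finset.univ : Finset β)) (fun i b => w i b)
  simp only [hw.sum_eq_one, Finset.prod_const_one, Fintype.piFinset_univ] at h
  exact h.symm

theorem expect_mono (hw : IsWeight w) {F G : (ι → β) → ℝ} (h : ∀ a, F a ≤ G a) :
    expect w F ≤ expect w G :=
  Finset.sum_le_sum fun a _ => mul_le_mul_of_nonneg_left (h a) (weight_nonneg hw a)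

theorem expect_nonneg (hw : IsWeight w) {F : (ι → β) → ℝ} (h : ∀ a, 0 ≤ F a) :
    0 ≤ expect w F :=
  Finset.sum_nonneg fun a _ => mul_nonneg (weight_nonneg hw a) (h a)

theorem expect_const (hw : IsWeight w) (r : ℝ) : expect w (fun _ => r) = r := by
  rw [expect, ← Finset.sum_mul, sum_weight hw, one_mul]

theorem expect_add (F G : (ι → β) → ℝ) :
    expect w (fun a => F a + G a) = expect w F + expect w G := by
  simp only [expect, mul_add, Finset.sum_add_distrib]

theorem expect_sub (F G : (ι → β) → ℝ) :
    expect w (fun a => F a - G a) = expect w F - expect w G := by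
  simp only [expect, mul_sub, Finset.sum_sub_distrib]

theorem expect_mul_left (r : ℝ) (F : (ι → β) → ℝ) :
    expect w (fun a => r * F a) = r * expect w F := by
  simp only [expect, Finset.mul_sum, mul_left_comm]

theorem expect_sum {κ : Type*} (s : Finset κ) (F : κ → (ι → β) → ℝ) :
    expect w (fun a => ∑ k ∈ s, F k a) = ∑ k ∈ s, expect w (F k) := by
  simp only [expect, Finset.mul_sum]
  exact Finset.sum_comm

theorem prob_nonneg (hw : IsWeight w) (A : Set (ι → β)) : 0 ≤ prob w A :=
  expect_nonneg hw fun a => by split_ifs <;> norm_num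

theorem prob_mono (hw : IsWeight w) {A B : Set (ι → β)} (h : A ⊆ B) : prob w A ≤ prob w B :=
  expect_mono hw fun a => by
    by_cases ha : a ∈ A
    · simp [ha, h ha]
    · simp only [ha, if_false]
      split_ifs <;> norm_num

theorem prob_univ (hw : IsWeight w) : prob w Set.univ = 1 := by
  simp [prob, expect_const hw]

theorem prob_le_one (hw : IsWeight w) (A : Set (ι → β)) : prob w A ≤ 1 :=
  (prob_mono hw (Set.subset_univ A)).trans (prob_univ hw).le

theorem prob_empty : prob w (∅ : Set (ι → β)) = 0 := by simp [prob, expect]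

theorem prob_union_le (hw : IsWeight w) (A B : Set (ι → β)) :
    prob w (A ∪ B) ≤ prob w A + prob w B := by
  rw [prob, prob, prob, ← expect_add]
  refine expect_mono hw fun a => ?_
  by_cases ha : a ∈ A <;> by_cases hb : a ∈ B <;> simp [ha, hb]

theorem prob_inter_add_diff (A B : Set (ι → β)) :
    prob w (A ∩ B) + prob w (A \ B) = prob w A := by
  rw [prob, prob, prob, ← expect_add]
  congr 1
  ext a
  by_cases ha : a ∈ A <;> by_cases hb : a ∈ B <;> simp [ha, hb]

theorem prob_compl (hw : IsWeight w) (A : Set (ι → β)) : prob w Aᶜ = 1 - prob w A := by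
  have h := prob_inter_add_diff (w := w) Set.univ A
  rw [prob_univ hw, Set.univ_inter, ← Set.compl_eq_univ_sdiff] at h
  linarith

theorem prob_biUnion_le (hw : IsWeight w) {κ : Type*} (s : Finset κ) (A : κ → Set (ι → β)) :
    prob w (⋃ k ∈ s, A k) ≤ ∑ k ∈ s, prob w (A k) := by
  classical
  induction s using Finset.induction_on with
  | empty => simp [prob_empty]
  | insert k s hk ih =>
    rw [Finset.set_biUnion_insert, Finset.sum_insert hk]
    exact (prob_union_le hw _ _).trans (by linarith)

theorem exists_of_prob_pos {A : Set (ι → β)} (h : 0 < prob w A) :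
    ∃ a ∈ A, weight w a ≠ 0 := by
  by_contra! hA
  refine h.ne' (Finset.sum_eq_zero fun a _ => ?_)
  by_cases ha : a ∈ A
  · simp [hA a ha]
  · simp [ha]

theorem mul_prob_le_expect (hw : IsWeight w) {F : (ι → β) → ℝ} {A : Set (ι → β)} {r : ℝ}
    (h0 : ∀ a, 0 ≤ F a) (h : ∀ a ∈ A, r ≤ F a) : r * prob w A ≤ expect w F := by
  rw [prob, ← expect_mul_left]
  refine expect_mono hw fun a => ?_
  by_cases ha : a ∈ A
  · simpa [ha] using h a ha
  · simpa [ha] using h0 a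

theorem prob_forall_mem [DecidableEq β] (s : ι → Finset β) :
    prob w {a | ∀ i, a i ∈ s i} = ∏ i, ∑ b ∈ s i, w i b := by
  rw [Finset.prod_univ_sum, prob, expect]
  simp only [Set.mem_ofPred_eq, mul_ite, mul_one, mul_zero]
  rw [← Finset.sum_filter]
  refine Finset.sum_congr ?_ fun _ _ => rfl
  ext a
  simp [Fintype.mem_piFinset]

/-- Functions of disjoint sets of coordinates are uncorrelated. -/
theorem expect_mul_of_dependsOn (hw : IsWeight w) {F G : (ι → β) → ℝ} (S : Finset ι)
    (hF : ∀ a b, (∀ i ∈ S, a i = b i) → F a = F b)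
    (hG : ∀ a b, (∀ i, i ∉ S → a i = b i) → G a = G b) :
    expect w (fun a => F a * G a) = expect w F * expect w G := by
  -- Take two independent copies and exchange their coordinates outside `S`. This involution
  -- preserves the joint weight, and the new first point sees the `F`-value of one copy and the
  -- `G`-value of the other.
  have key : ∑ p : (ι → β) × (ι → β), weight w p.1 * weight w p.2 * (F p.1 * G p.2) =
      ∑ p : (ι → β) × (ι → β), weight w p.1 * weight w p.2 * (F p.1 * G p.1) := by
    let σ : (ι → β) × (ι → β) → (ι → β) × (ι → β) :=
      fun p => (S.piecewise p.1 p.2, S.piecewise p.2 p.1)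
    have hσ : Function.Involutive σ := by
      rintro ⟨a, b⟩
      simp only [σ, Prod.mk.injEq]
      constructor <;> ext i <;> by_cases hi : i ∈ S <;> simp [hi]
    refine Fintype.sum_equiv hσ.toPerm _ _ ?_
    rintro ⟨a, b⟩
    have h1 : F (S.piecewise a b) = F a := hF _ _ fun i hi => by simp [hi]
    have h2 : G (S.piecewise a b) = G b := hG _ _ fun i hi => by simp [hi]
    have h3 : weight w (S.piecewise a b) * weight w (S.piecewise b a) =
        weight w a * weight w b := by
      simp only [weight, ← Finset.prod_mul_distrib]
      refine Finset.prod_congr rfl fun i _ => ?_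
      by_cases hi : i ∈ S <;> simp [hi, mul_comm]
    change _ = weight w (S.piecewise a b) * weight w (S.piecewise b a) *
      (F (S.piecewise a b) * G (S.piecewise a b))
    rw [h1, h2, h3]
  have hL : ∑ p : (ι → β) × (ι → β), weight w p.1 * weight w p.2 * (F p.1 * G p.2) =
      expect w F * expect w G := by
    rw [Fintype.sum_prod_type, expect, expect, Finset.sum_mul_sum]
    refine Finset.sum_congr rfl fun a _ => Finset.sum_congr rfl fun b _ => by ring
  have hR : ∑ p : (ι → β) × (ι → β), weight w p.1 * weight w p.2 * (F p.1 * G p.1) =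
      expect w (fun a => F a * G a) := by
    rw [Fintype.sum_prod_type, expect]
    refine Finset.sum_congr rfl fun a _ => ?_
    rw [← mul_one (weight w a * (F a * G a)), ← sum_weight hw, Finset.mul_sum]
    refine Finset.sum_congr rfl fun b _ => by ring
  rw [← hL, ← hR, key]

theorem prob_inter_of_dependsOn (hw : IsWeight w) {A B : Set (ι → β)} (S : Finset ι)
    (hA : ∀ a b, (∀ i ∈ S, a i = b i) → (a ∈ A ↔ b ∈ A))
    (hB : ∀ a b, (∀ i, i ∉ S → a i = b i) → (a ∈ B ↔ b ∈ B)) :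
    prob w (A ∩ B) = prob w A * prob w B := by
  classical
  rw [prob, prob, prob, ← expect_mul_of_dependsOn hw S
    (fun a b h => by simp only [hA a b h]) (fun a b h => by simp only [hB a b h])]
  congr 1
  ext a
  by_cases ha : a ∈ A <;> by_cases hb : a ∈ B <;> simp [ha, hb]

/-- The symmetric Lovász local lemma for events determined by few coordinates. -/
theorem exists_avoiding (hw : IsWeight w) {κ : Type*} [Fintype κ] (B : κ → Set (ι → β))
    (S : κ → Finset ι) (q : ℝ) (D : ℕ)
    (hB : ∀ k a b, (∀ i ∈ S k, a i = b i) → (a ∈ B k ↔ b ∈ B k))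
    (hq : ∀ k, prob w (B k) ≤ q)
    (hD : ∀ k, {j : κ | ¬ Disjoint (S k) (S j)}.ncard ≤ D)
    (hqD : 4 * D * q ≤ 1) (hq4 : q ≤ 1 / 4) :
    ∃ a, weight w a ≠ 0 ∧ ∀ k, a ∉ B k := by
  classical
  let av : Finset κ → Set (ι → β) := fun T => {a | ∀ k ∈ T, a ∉ B k}
  by_cases hκ : Nonempty κ
  swap
  · obtain ⟨a, -, ha⟩ := exists_of_prob_pos (w := w) (A := Set.univ)
      (by rw [prob_univ hw]; norm_num)
    exact ⟨a, ha, fun k => (hκ ⟨k⟩).elim⟩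
  have hq0 : 0 ≤ q := (prob_nonneg hw _).trans (hq hκ.some)
  have hmono : ∀ {T T' : Finset κ}, T ⊆ T' → av T' ⊆ av T :=
    fun h a ha k hk => ha k (h hk)
  have hunion : ∀ T T' : Finset κ,
      prob w (av T) - ∑ j ∈ T', prob w (B j ∩ av T) ≤ prob w (av (T ∪ T')) := by
    intro T T'
    have h1 : av T ⊆ av (T ∪ T') ∪ ⋃ j ∈ T', (B j ∩ av T) := by
      intro a ha
      by_cases h : a ∈ av (T ∪ T')
      · exact Or.inl h
      · right
        simp only [av, Set.mem_ofPred_eq, not_forall, not_not] at h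
        obtain ⟨k, hk, hak⟩ := h
        rcases Finset.mem_union.1 hk with hk | hk
        · exact (ha k hk hak).elim
        · exact Set.mem_biUnion hk ⟨hak, ha⟩
    have h2 := (prob_mono hw h1).trans (prob_union_le hw _ _)
    have h3 := prob_biUnion_le hw T' (fun j => B j ∩ av T)
    linarith
  -- Conditioned on avoiding the events in `T`, every bad event has probability at most 2q. The
  -- bound is written multiplicatively, and positivity is carried along in the induction.
  have main : ∀ n : ℕ, ∀ T : Finset κ, T.card ≤ n →
      0 < prob w (av T) ∧ ∀ k, prob w (B k ∩ av T) ≤ 2 * q * prob w (av T) := by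
    intro n
    induction n with
    | zero =>
      intro T hT
      have hT' : T = ∅ := Finset.card_eq_zero.1 (Nat.le_zero.1 hT)
      have : av T = Set.univ := by simp [av, hT']
      rw [this, prob_univ hw]
      refine ⟨one_pos, fun k => ?_⟩
      rw [Set.inter_univ]
      linarith [hq k]
    | succ n ih =>
      have step : ∀ T : Finset κ, T.card ≤ n + 1 → ∀ k,
          prob w (B k ∩ av T) ≤ 2 * q * prob w (av T) := by
        intro T hT k
        by_cases hcap : ∃ j ∈ T, ¬ Disjoint (S k) (S j)
        swap
        · push Not at hcap
          rw [prob_inter_of_dependsOn hw (S k) (hB k)]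
          · have := prob_nonneg hw (av T)
            nlinarith [hq k]
          · intro a b hab
            refine forall₂_congr fun j hj => not_congr (hB j a b fun i hi => hab i ?_)
            exact fun hi' => Finset.disjoint_left.1 (hcap j hj) hi' hi
        obtain ⟨j₀, hj₀, hj₀'⟩ := hcap
        let T₁ := T.filter fun j => ¬ Disjoint (S k) (S j)
        let T₂ := T.filter fun j => Disjoint (S k) (S j)
        have hT₂ : T₂.card ≤ n := by
          have : T₂ ⊂ T := Finset.filter_ssubset.2 ⟨j₀, hj₀, hj₀'⟩
          have := Finset.card_lt_card this
          omega
        have hU : T₂ ∪ T₁ = T := Finset.filter_union_filter_not_eq _ T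
        obtain ⟨hpos, hbd⟩ := ih T₂ hT₂
        have h1 : prob w (B k ∩ av T) ≤ q * prob w (av T₂) := by
          refine (prob_mono hw (Set.inter_subset_inter_right _
            (hmono (Finset.filter_subset _ T)))).trans (?_ : prob w (B k ∩ av T₂) ≤ _)
          rw [prob_inter_of_dependsOn hw (S k) (hB k)]
          · exact mul_le_mul_of_nonneg_right (hq k) hpos.le
          · intro a b hab
            refine forall₂_congr fun j hj => not_congr (hB j a b fun i hi => hab i ?_)
            exact fun hi' => Finset.disjoint_left.1 (Finset.mem_filter.1 hj).2 hi' hi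
        have hcard : (T₁.card : ℝ) ≤ D := by
          have h := hD k
          have h' : (T₁ : Set κ).ncard ≤ {j : κ | ¬ Disjoint (S k) (S j)}.ncard :=
            Set.ncard_le_ncard (fun j hj => (Finset.mem_filter.1 hj).2) (Set.toFinite _)
          rw [Set.ncard_coe_finset] at h'
          exact_mod_cast h'.trans h
        have h2 : ∑ j ∈ T₁, prob w (B j ∩ av T₂) ≤ D * (2 * q * prob w (av T₂)) := by
          refine (Finset.sum_le_card_nsmul _ _ _ fun j _ => hbd j).trans ?_
          rw [nsmul_eq_mul]
          exact mul_le_mul_of_nonneg_right hcard (by positivity)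
        have h3 := hunion T₂ T₁
        rw [hU] at h3
        -- Restoring the at most `D` events of `T₁` loses a proportion of at most D · 2q ≤ 1/2.
        have h4 : prob w (av T₂) ≤ 2 * prob w (av T) := by
          have : (4 * D * q) * prob w (av T₂) ≤ 1 * prob w (av T₂) :=
            mul_le_mul_of_nonneg_right hqD hpos.le
          linarith
        nlinarith
      intro T hT
      refine ⟨?_, step T hT⟩
      rcases T.eq_empty_or_nonempty with rfl | ⟨k, hk⟩
      · simp [av, prob_univ hw]
      have hc : (T.erase k).card ≤ n := by
        rw [Finset.card_erase_of_mem hk]; omega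
      obtain ⟨hpos, hbd⟩ := ih _ hc
      have h3 := hunion (T.erase k) {k}
      rw [Finset.sum_singleton, Finset.union_comm, ← Finset.insert_eq,
        Finset.insert_erase hk] at h3
      have hbk := hbd k
      nlinarith
  obtain ⟨a, ha, hwa⟩ := exists_of_prob_pos (main _ Finset.univ le_rfl).1
  exact ⟨a, hwa, fun k => ha k (Finset.mem_univ k)⟩

/-! ### Talagrand's convex distance inequality. -/

section Talagrand

/-- The vectors dominating the indicator of disagreement between `x` and some point of `A`. -/
def disagreement {ι β : Type*} (A : Set (ι → β)) (x : ι → β) : Set (ι → ℝ) :=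
  {v | ∃ y ∈ A, ∀ i, 0 ≤ v i ∧ (x i ≠ y i → 1 ≤ v i)}

/-- Prepending a fixed coordinate `t` is an affine map, so it is enough to treat the generating
vectors. The inductive step uses `t = 0` with the fiber of `A` over `ω`, and `t = 1` with the
projection of `A`. -/
theorem cons_mem_convexHull_disagreement {β : Type*} {n : ℕ} {A : Set (Fin (n + 1) → β)}
    {B : Set (Fin n → β)} {ω : β} {x : Fin n → β} {t : ℝ} (ht : 0 ≤ t)
    (h : ∀ y ∈ B, ∃ ω', Fin.cons ω' y ∈ A ∧ (ω ≠ ω' → 1 ≤ t)) {v : Fin n → ℝ}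
    (hv : v ∈ convexHull ℝ (disagreement B x)) :
    (Fin.cons t v : Fin (n + 1) → ℝ) ∈ convexHull ℝ (disagreement A (Fin.cons ω x)) := by
  let K : Set (Fin n → ℝ) :=
    {v | (Fin.cons t v : Fin (n + 1) → ℝ) ∈ convexHull ℝ (disagreement A (Fin.cons ω x))}
  have hK : Convex ℝ K := by
    intro v hv v' hv' a b ha hb hab
    have := (convex_convexHull ℝ (disagreement A (Fin.cons ω x : Fin (n + 1) → β))) hv hv' ha hb hab
    change (Fin.cons t (a • v + b • v') : Fin (n + 1) → ℝ) ∈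
      convexHull ℝ (disagreement A (Fin.cons ω x))
    convert this using 1
    ext i
    refine Fin.cases ?_ (fun i => ?_) i
    · simp [← add_mul, hab]
    · simp
  refine convexHull_min ?_ hK hv
  rintro v ⟨y, hy, hyv⟩
  obtain ⟨ω', hω', ht'⟩ := h y hy
  refine subset_convexHull ℝ _ ⟨Fin.cons ω' y, hω', fun i => ?_⟩
  refine Fin.cases ?_ (fun i => ?_) i
  · simpa using ⟨ht, ht'⟩
  · simpa using hyv i

theorem expect_succ {β : Type*} [Fintype β] {n : ℕ} (w : Fin (n + 1) → β → ℝ)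
    (F : (Fin (n + 1) → β) → ℝ) :
    expect w F = ∑ ω, w 0 ω * expect (fun i => w i.succ) (fun x => F (Fin.cons ω x)) := by
  rw [expect, ← (Fin.consEquiv fun _ => β).sum_comp, Fintype.sum_prod_type]
  refine Finset.sum_congr rfl fun ω _ => ?_
  rw [expect, Finset.mul_sum]
  refine Finset.sum_congr rfl fun x _ => ?_
  simp [weight, Fin.consEquiv, Fin.prod_univ_succ, mul_assoc]

/-- The one-variable inequality behind the inductive step. Bounding both logarithms by 1 − 1/x ≤ log
x leaves a rational inequality whose difference has the factor (1 − r)². -/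
theorem exp_interpolation_le {r : ℝ} (h : 2 / 3 ≤ r) (h1 : r ≤ 1) :
    Real.exp (1 / 18 * (3 * (1 - r)) ^ 2 - (3 * r - 2) * Real.log r) ≤ 2 - r := by
  have hr : 0 < r := by linarith
  rw [← Real.le_log_iff_exp_le (by linarith)]
  have h2 : 1 - 1 / (2 - r) ≤ Real.log (2 - r) := by
    have := Real.one_sub_inv_le_log_of_pos (show 0 < 2 - r by linarith)
    rwa [one_div]
  have h3 : 1 - 1 / r ≤ Real.log r := by
    have := Real.one_sub_inv_le_log_of_pos hr
    rwa [one_div]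
  have h4 : 1 / 18 * (3 * (1 - r)) ^ 2 - (3 * r - 2) * (1 - 1 / r) ≤ 1 - 1 / (2 - r) := by
    have h5 : 0 < 2 - r := by linarith
    rw [← sub_nonneg]
    have : 1 - 1 / (2 - r) - (1 / 18 * (3 * (1 - r)) ^ 2 - (3 * r - 2) * (1 - 1 / r)) =
        (1 - r) ^ 2 * (1 / 2 + 3 * (1 - r) + (1 - r) ^ 2 / 2) / (r * (2 - r)) := by
      field_simp
      ring
    rw [this]
    have : 0 ≤ 1 - r := by linarith
    positivity
  nlinarith [mul_le_mul_of_nonneg_left h3 (show 0 ≤ 3 * r - 2 by linarith)]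

/-- Talagrand's convex distance inequality on a finite product space. -/
theorem exists_convexHull_disagreement {β : Type*} [Fintype β] (n : ℕ) :
    ∀ (w : Fin n → β → ℝ), IsWeight w → ∀ A : Set (Fin n → β), 0 < prob w A →
    ∃ V : (Fin n → β) → Fin n → ℝ, (∀ x, V x ∈ convexHull ℝ (disagreement A x)) ∧
      prob w A * expect w (fun x => Real.exp (1 / 18 * ∑ i, V x i ^ 2)) ≤ 1 := by
  induction n with
  | zero =>
    intro w hw A hA
    obtain ⟨a, ha, -⟩ := exists_of_prob_pos hA
    refine ⟨fun _ _ => 0, fun x => subset_convexHull ℝ _ ⟨a, ha, fun i => i.elim0⟩, ?_⟩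
    simpa [expect_const hw] using prob_le_one hw A
  | succ n ih =>
    intro w hw A hA
    set w' : Fin n → β → ℝ := fun i => w i.succ with hw'_def
    have hw' : IsWeight w' := ⟨fun i => hw.nonneg i.succ, fun i => hw.sum_eq_one i.succ⟩
    let fib : β → Set (Fin n → β) := fun ω => {y | Fin.cons ω y ∈ A}
    let B : Set (Fin n → β) := {y | ∃ ω, (Fin.cons ω y : Fin (n + 1) → β) ∈ A}
    have hfibB : ∀ ω, fib ω ⊆ B := fun ω y hy => ⟨ω, hy⟩
    have hPA : prob w A = ∑ ω, w 0 ω * prob w' (fib ω) := by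
      rw [prob, expect_succ]
      rfl
    have hPfib : ∀ ω, prob w' (fib ω) ≤ prob w' B := fun ω => prob_mono hw' (hfibB ω)
    have hAB : prob w A ≤ prob w' B := by
      rw [hPA]
      calc ∑ ω, w 0 ω * prob w' (fib ω) ≤ ∑ ω, w 0 ω * prob w' B :=
            Finset.sum_le_sum fun ω _ => mul_le_mul_of_nonneg_left (hPfib ω) (hw.nonneg 0 ω)
        _ = prob w' B := by rw [← Finset.sum_mul, hw.sum_eq_one, one_mul]
    have hB : 0 < prob w' B := hA.trans_le hAB
    obtain ⟨VB, hVB, hEB⟩ := ih w' hw' B hB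
    -- The bound 2 − r is affine in the ratio r of fiber to projection, so averaging it over `ω`
    -- gives exactly 2 − P(A)/P(B).
    have claim : ∀ ω, ∃ V : (Fin n → β) → Fin (n + 1) → ℝ,
        (∀ x, V x ∈ convexHull ℝ (disagreement A (Fin.cons ω x))) ∧
        prob w' B * expect w' (fun x => Real.exp (1 / 18 * ∑ i, V x i ^ 2)) ≤
          2 - prob w' (fib ω) / prob w' B := by
      intro ω
      set r := prob w' (fib ω) / prob w' B with hr
      have hr1 : r ≤ 1 := div_le_one_of_le₀ (hPfib ω) hB.le
      have hB1 : ∀ x, (Fin.cons 1 (VB x) : Fin (n + 1) → ℝ) ∈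
          convexHull ℝ (disagreement A (Fin.cons ω x)) := fun x =>
        cons_mem_convexHull_disagreement zero_le_one
          (fun y hy => hy.imp fun ω' h => ⟨h, fun _ => le_rfl⟩) (hVB x)
      rcases le_or_gt r (2 / 3) with hr23 | hr23
      -- A small fiber is ignored: changing the first coordinate costs exp(1/18) ≤ 4/3 ≤ 2 − r.
      · refine ⟨fun x => Fin.cons 1 (VB x), hB1, ?_⟩
        simp only [Fin.sum_univ_succ, Fin.cons_zero, Fin.cons_succ, mul_add, Real.exp_add,
          expect_mul_left]
        have h1 : Real.exp (1 / 18 * 1 ^ 2) ≤ 4 / 3 := by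
          have := Real.exp_bound_div_one_sub_of_interval' (x := 1 / 18) (by norm_num) (by norm_num)
          norm_num at this ⊢
          linarith
        have h2 : 0 ≤ expect w' fun x => Real.exp (1 / 18 * ∑ i, VB x i ^ 2) :=
          expect_nonneg hw' fun x => (Real.exp_pos _).le
        nlinarith [mul_nonneg hB.le h2]
      · have hfib : 0 < prob w' (fib ω) := by
          by_contra h
          have h0 : prob w' (fib ω) = 0 := le_antisymm (not_lt.1 h) (prob_nonneg hw' _)
          rw [hr, h0, zero_div] at hr23
          norm_num at hr23
        obtain ⟨Vf, hVf, hEf⟩ := ih w' hw' (fib ω) hfib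
        -- The weight given to the fiber rises linearly from 0 at r = 2/3 to 1 at r = 1. Convexity
        -- of squares and of the exponential then separates the two inductive bounds.
        set l := 3 * r - 2 with hl
        have hl0 : 0 ≤ l := by linarith
        have hl1 : 0 ≤ 1 - l := by linarith
        refine ⟨fun x => l • (Fin.cons 0 (Vf x) : Fin (n + 1) → ℝ) +
          (1 - l) • (Fin.cons 1 (VB x) : Fin (n + 1) → ℝ), fun x => ?_, ?_⟩
        · refine convex_convexHull ℝ _ ?_ (hB1 x) hl0 hl1 (by ring)
          exact cons_mem_convexHull_disagreement le_rfl
            (fun y hy => ⟨ω, hy, fun h => (h rfl).elim⟩) (hVf x)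
        · have hpt : ∀ x, Real.exp (1 / 18 * ∑ i, (l • (Fin.cons 0 (Vf x) : Fin (n + 1) → ℝ) +
              (1 - l) • (Fin.cons 1 (VB x) : Fin (n + 1) → ℝ)) i ^ 2) ≤
              Real.exp (1 / 18 * (1 - l) ^ 2 - l * Real.log (prob w' (fib ω)) -
                (1 - l) * Real.log (prob w' B)) *
              (l * (prob w' (fib ω) * Real.exp (1 / 18 * ∑ i, Vf x i ^ 2)) +
                (1 - l) * (prob w' B * Real.exp (1 / 18 * ∑ i, VB x i ^ 2))) := by
            intro x
            set u := 1 / 18 * ∑ i, Vf x i ^ 2 with hu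
            set v := 1 / 18 * ∑ i, VB x i ^ 2 with hv
            have h1 : 1 / 18 * ∑ i, (l • (Fin.cons 0 (Vf x) : Fin (n + 1) → ℝ) +
                (1 - l) • (Fin.cons 1 (VB x) : Fin (n + 1) → ℝ)) i ^ 2 ≤
                1 / 18 * (1 - l) ^ 2 + (l * u + (1 - l) * v) := by
              have h2 : ∑ i, (l * Vf x i + (1 - l) * VB x i) ^ 2 ≤
                  l * ∑ i, Vf x i ^ 2 + (1 - l) * ∑ i, VB x i ^ 2 := by
                rw [Finset.mul_sum, Finset.mul_sum, ← Finset.sum_add_distrib]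
                refine Finset.sum_le_sum fun i _ => ?_
                nlinarith [mul_nonneg (mul_nonneg hl0 hl1) (sq_nonneg (Vf x i - VB x i))]
              rw [Fin.sum_univ_succ]
              simp only [Pi.add_apply, Pi.smul_apply, Fin.cons_zero, Fin.cons_succ, smul_eq_mul]
              rw [hu, hv]
              linarith
            have h3 := convexOn_exp.2 (Set.mem_univ (u + Real.log (prob w' (fib ω))))
              (Set.mem_univ (v + Real.log (prob w' B))) hl0 hl1 (by ring)
            simp only [smul_eq_mul, Real.exp_add, Real.exp_log hfib, Real.exp_log hB] at h3
            calc _ ≤ Real.exp (1 / 18 * (1 - l) ^ 2 + (l * u + (1 - l) * v)) :=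
                  Real.exp_le_exp.2 h1
              _ = Real.exp (1 / 18 * (1 - l) ^ 2 - l * Real.log (prob w' (fib ω)) -
                    (1 - l) * Real.log (prob w' B)) *
                  (Real.exp (l * (u + Real.log (prob w' (fib ω)))) *
                    Real.exp ((1 - l) * (v + Real.log (prob w' B)))) := by
                  rw [← Real.exp_add, ← Real.exp_add]
                  congr 1
                  ring
              _ ≤ _ := by
                  refine mul_le_mul_of_nonneg_left ?_ (Real.exp_pos _).le
                  refine h3.trans (le_of_eq ?_)
                  ring
          have hE := expect_mono hw' hpt
          rw [expect_mul_left, expect_add, expect_mul_left, expect_mul_left, expect_mul_left,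
            expect_mul_left] at hE
          have hmix : l * (prob w' (fib ω) * expect w' fun x =>
              Real.exp (1 / 18 * ∑ i, Vf x i ^ 2)) + (1 - l) * (prob w' B * expect w' fun x =>
              Real.exp (1 / 18 * ∑ i, VB x i ^ 2)) ≤ 1 := by
            nlinarith [mul_le_mul_of_nonneg_left hEf hl0, mul_le_mul_of_nonneg_left hEB hl1]
          have hE' := hE.trans (mul_le_mul_of_nonneg_left hmix (Real.exp_pos _).le)
          have hlog : Real.log r = Real.log (prob w' (fib ω)) - Real.log (prob w' B) :=
            Real.log_div hfib.ne' hB.ne'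
          have hI := exp_interpolation_le hr23.le hr1
          calc _ ≤ prob w' B * (Real.exp (1 / 18 * (1 - l) ^ 2 -
                  l * Real.log (prob w' (fib ω)) - (1 - l) * Real.log (prob w' B)) * 1) :=
                mul_le_mul_of_nonneg_left hE' hB.le
            _ = Real.exp (1 / 18 * (3 * (1 - r)) ^ 2 - (3 * r - 2) * Real.log r) := by
                rw [mul_one]
                nth_rewrite 1 [← Real.exp_log hB]
                rw [← Real.exp_add, hlog, ← hl]
                congr 1
                ring
            _ ≤ 2 - r := hI
    choose V hV hE using claim
    refine ⟨fun x => V (x 0) (Fin.tail x), fun x => ?_, ?_⟩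
    · have := hV (x 0) (Fin.tail x)
      rwa [Fin.cons_self_tail] at this
    · rw [expect_succ]
      simp only [Fin.cons_zero, Fin.tail_cons]
      set b := prob w' B with hb
      set p := prob w A with hp
      have h1 : b * ∑ ω, w 0 ω * expect w' (fun x => Real.exp (1 / 18 * ∑ i, V ω x i ^ 2)) ≤
          2 - p / b := by
        have : ∑ ω, w 0 ω * (2 - prob w' (fib ω) / b) = 2 - p / b := by
          simp only [mul_sub, Finset.sum_sub_distrib, ← Finset.sum_mul, hw.sum_eq_one]
          rw [hPA, Finset.sum_div]
          simp only [mul_div_assoc, one_mul]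
        rw [← this, Finset.mul_sum]
        refine Finset.sum_le_sum fun ω _ => ?_
        rw [mul_left_comm]
        exact mul_le_mul_of_nonneg_left (hE ω) (hw.nonneg 0 ω)
      set s := ∑ ω, w 0 ω * expect w' (fun x => Real.exp (1 / 18 * ∑ i, V ω x i ^ 2)) with hs
      have h2 : s ≤ (2 - p / b) / b := by
        rw [le_div_iff₀ hB]
        linarith
      -- With x = P(A)/P(B) the final bound is x(2 − x) = 1 − (1 − x)² ≤ 1.
      calc p * s ≤ p * ((2 - p / b) / b) := mul_le_mul_of_nonneg_left h2 hA.le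
        _ = 1 - (1 - p / b) ^ 2 := by field_simp; ring
        _ ≤ 1 := by nlinarith [sq_nonneg (1 - p / b)]

end Talagrand

/-! ### Concentration of certifiable variables. -/

variable {ι β : Type*} [Fintype ι]

/-- `X` drops by at most the number of changes made on a set of at most `3 * X a` coordinates. -/
def Certifiable (X : (ι → β) → ℕ) : Prop :=
  ∀ a, ∃ J : Finset ι, J.card ≤ 3 * X a ∧
    ∀ b, X a ≤ X b + {i | i ∈ J ∧ a i ≠ b i}.ncard

variable [Fintype β] [DecidableEq ι]

theorem expect_comp_equiv {w : ι → β → ℝ} {n : ℕ} (e : ι ≃ Fin n) (F : (ι → β) → ℝ) :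
    expect w F = expect (fun j => w (e.symm j)) (fun x => F (x ∘ e)) := by
  rw [expect, expect, ← (e.arrowCongr (Equiv.refl β)).symm.sum_comp]
  refine Finset.sum_congr rfl fun x _ => ?_
  congr 1
  simp only [weight]
  rw [← e.prod_comp]
  simp

/-- Where X = N ≥ s + t, summing over the certificate is a linear functional that is at least N − s
on every disagreement vector to {X ≤ s}, hence on their convex hull. Cauchy–Schwarz over at most 3N
coordinates gives (N − s)² ≤ 3N · ∑ V². Since (N − s)²/N increases with N, the worst case is N = s +
t, and 54 = 3 · 18. -/
theorem prob_mul_prob_le {w : ι → β → ℝ} (hw : IsWeight w) {X : (ι → β) → ℕ}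
    (hX : Certifiable X) {s t : ℝ} (hs : 0 ≤ s) (ht : 0 < t) :
    prob w {a | (X a : ℝ) ≤ s} * prob w {a | s + t ≤ X a} ≤
      Real.exp (-(t ^ 2 / (54 * (s + t)))) := by
  classical
  set A : Set (ι → β) := {a | (X a : ℝ) ≤ s} with hAdef
  rcases (prob_nonneg hw A).eq_or_lt with hA | hA
  · rw [← hA, zero_mul]
    exact (Real.exp_pos _).le
  let e := Fintype.equivFin ι
  let w' : Fin (Fintype.card ι) → β → ℝ := fun j => w (e.symm j)
  have hw' : IsWeight w' := ⟨fun j => hw.nonneg _, fun j => hw.sum_eq_one _⟩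
  let A' : Set (Fin (Fintype.card ι) → β) := {x | x ∘ e ∈ A}
  have hAA' : prob w A = prob w' A' := expect_comp_equiv e _
  obtain ⟨V, hV, hE⟩ := exists_convexHull_disagreement _ w' hw' A' (hAA' ▸ hA)
  have hBB' : prob w {a | s + t ≤ X a} = prob w' {x | s + t ≤ X (x ∘ e)} := expect_comp_equiv e _
  have hbound : ∀ x ∈ {x : Fin (Fintype.card ι) → β | s + t ≤ X (x ∘ e)},
      Real.exp (t ^ 2 / (54 * (s + t))) ≤ Real.exp (1 / 18 * ∑ i, V x i ^ 2) := by
    intro x hx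
    have hx' : s + t ≤ X (x ∘ e) := hx
    obtain ⟨J, hJ, hJX⟩ := hX (x ∘ e)
    have hlin : (X (x ∘ e) : ℝ) - s ≤ ∑ i ∈ J, V x (e i) := by
      let K : Set (Fin (Fintype.card ι) → ℝ) := {v | (X (x ∘ e) : ℝ) - s ≤ ∑ i ∈ J, v (e i)}
      have hK : Convex ℝ K := by
        intro v hv v' hv' a b ha hb hab
        have h1 : (X (x ∘ e) : ℝ) - s ≤ ∑ i ∈ J, v (e i) := hv
        have h2 : (X (x ∘ e) : ℝ) - s ≤ ∑ i ∈ J, v' (e i) := hv'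
        change (X (x ∘ e) : ℝ) - s ≤ ∑ i ∈ J, (a • v + b • v') (e i)
        simp only [Pi.add_apply, Pi.smul_apply, smul_eq_mul, Finset.sum_add_distrib,
          ← Finset.mul_sum]
        have : (X (x ∘ e) : ℝ) - s = a * (X (x ∘ e) - s) + b * (X (x ∘ e) - s) := by
          rw [← add_mul, hab, one_mul]
        rw [this]
        gcongr
      refine convexHull_min ?_ hK (hV x)
      rintro v ⟨y, hy, hyv⟩
      have h1 := hJX (y ∘ e)
      have h2 : (X (y ∘ e) : ℝ) ≤ s := hy
      have h3 : ({i | i ∈ J ∧ (x ∘ e) i ≠ (y ∘ e) i}.ncard : ℝ) ≤ ∑ i ∈ J, v (e i) := by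
        have : {i | i ∈ J ∧ (x ∘ e) i ≠ (y ∘ e) i} =
            ((J.filter fun i => x (e i) ≠ y (e i) : Finset ι) : Set ι) := by
          ext i; simp
        rw [this, Set.ncard_coe_finset, Finset.card_filter]
        push_cast
        refine Finset.sum_le_sum fun i _ => ?_
        split_ifs with h
        · exact (hyv (e i)).2 h
        · exact (hyv (e i)).1
      have h4 : (X (x ∘ e) : ℝ) ≤ X (y ∘ e) +
          ({i | i ∈ J ∧ (x ∘ e) i ≠ (y ∘ e) i}.ncard : ℝ) := by exact_mod_cast h1
      change (X (x ∘ e) : ℝ) - s ≤ ∑ i ∈ J, v (e i)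
      linarith
    set N : ℝ := (X (x ∘ e) : ℝ) with hN
    set D := ∑ i, V x i ^ 2 with hD
    have hcs : (∑ i ∈ J, V x (e i)) ^ 2 ≤ (3 * N) * D := by
      have h1 := sq_sum_le_card_mul_sum_sq (s := J) (f := fun i => V x (e i))
      have h2 : ∑ i ∈ J, V x (e i) ^ 2 ≤ D := by
        rw [hD, ← e.sum_comp]
        exact Finset.sum_le_univ_sum_of_nonneg fun i => sq_nonneg _
      have h3 : (J.card : ℝ) ≤ 3 * N := by rw [hN]; exact_mod_cast hJ
      exact h1.trans (mul_le_mul h3 h2 (Finset.sum_nonneg fun i _ => sq_nonneg _)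
        ((Nat.cast_nonneg _).trans h3))
    have hsq : (N - s) ^ 2 ≤ 3 * N * D :=
      (pow_le_pow_left₀ (by linarith) hlin 2).trans hcs
    rw [Real.exp_le_exp, div_le_iff₀ (by positivity)]
    have hNpos : 0 < N := by linarith
    have h5 : t ^ 2 * N ≤ (N - s) ^ 2 * (s + t) := by
      obtain ⟨y, hy⟩ : ∃ y, N = s + t + y := ⟨N - s - t, by ring⟩
      have hy0 : 0 ≤ y := by linarith
      rw [hy]
      have : (s + t + y - s) ^ 2 * (s + t) - t ^ 2 * (s + t + y) =
        y * (2 * t * s + t ^ 2 + y * (s + t)) := by ring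
      nlinarith [mul_nonneg hy0 (show 0 ≤ 2 * t * s + t ^ 2 + y * (s + t) by positivity)]
    have h6 : t ^ 2 * N ≤ (3 * D * (s + t)) * N := by
      nlinarith [mul_le_mul_of_nonneg_right hsq (show 0 ≤ s + t by linarith)]
    have := le_of_mul_le_mul_right h6 hNpos
    linarith
  have hM := mul_prob_le_expect hw' (fun x => (Real.exp_pos (1 / 18 * ∑ i, V x i ^ 2)).le) hbound
  rw [hAA', hBB', Real.exp_neg]
  rw [← one_div, le_div_iff₀ (Real.exp_pos _)]
  calc _ = prob w' A' * (Real.exp (t ^ 2 / (54 * (s + t))) *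
        prob w' {x | s + t ≤ X (x ∘ e)}) := by ring
    _ ≤ _ := mul_le_mul_of_nonneg_left hM (prob_nonneg hw' _)
    _ ≤ 1 := hE

/-- A difference of two certifiable variables is rarely much below its mean. -/
theorem prob_sub_le_expect_sub {w : ι → β → ℝ} (hw : IsWeight w) {X Y : (ι → β) → ℕ}
    (hX : Certifiable X) (hY : Certifiable Y) {B : ℕ} (hXB : ∀ a, X a ≤ B) (hYB : ∀ a, Y a ≤ B)
    {M δ : ℝ} (hXM : expect w (fun a => (X a : ℝ)) ≤ M) (hYM : expect w (fun a => (Y a : ℝ)) ≤ M)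
    (hδM : 1 ≤ δ * M) (hδ0 : 0 < δ) (hδ1 : δ ≤ 1) :
    prob w {a | (X a : ℝ) - Y a ≤
      expect w (fun a => (X a : ℝ)) - expect w (fun a => (Y a : ℝ)) - 4 * (δ * M)} ≤
      2 * (B + 1) * Real.exp (-(δ ^ 2 * M / 162)) := by
  set μ := expect w (fun a => (X a : ℝ)) with hμ
  set ν := expect w (fun a => (Y a : ℝ)) with hν
  have hM : 0 < M := pos_of_mul_pos_right (one_pos.trans_le hδM) hδ0.le
  have hμ0 : 0 ≤ μ := expect_nonneg hw fun a => Nat.cast_nonneg _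
  have hν0 : 0 ≤ ν := expect_nonneg hw fun a => Nat.cast_nonneg _
  set t := δ * M with ht
  have ht0 : 0 < t := one_pos.trans_le hδM
  have htM : t ≤ M := by rw [ht]; nlinarith
  -- Both tails have threshold at most 3M, the larger one being ν + 1 + t; hence 162 = 3 · 54.
  have hexp : ∀ m, 0 < m → m ≤ 3 * M →
      Real.exp (-(t ^ 2 / (54 * m))) ≤ Real.exp (-(δ ^ 2 * M / 162)) := by
    intro m hm hmM
    rw [Real.exp_le_exp, neg_le_neg_iff, le_div_iff₀ (by positivity), ht]
    nlinarith [mul_le_mul_of_nonneg_left hmM (show 0 ≤ δ ^ 2 * M by positivity)]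
  have hBpos : (0 : ℝ) ≤ B := Nat.cast_nonneg _
  have hlow : prob w {a | (X a : ℝ) ≤ μ - 1 - t} ≤
      (B + 1) * Real.exp (-(δ ^ 2 * M / 162)) := by
    rcases lt_or_ge (μ - 1 - t) 0 with hneg | hs
    · have : {a : ι → β | (X a : ℝ) ≤ μ - 1 - t} = ∅ := by
        ext a
        simpa using hneg.trans_le (Nat.cast_nonneg (X a))
      rw [this, prob_empty]
      positivity
    have h1 := prob_mul_prob_le hw hX hs ht0
    rw [show μ - 1 - t + t = μ - 1 by ring] at h1
    -- In place of a median: a variable bounded by `B` reaches its mean minus one with probability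
    -- at least 1/(B + 1). This costs only the factor `B + 1` in the tail bound.
    have h2 : 1 ≤ (B + 1) * prob w {a | μ - 1 ≤ (X a : ℝ)} := by
      classical
      have : μ ≤ (μ - 1) + B * prob w {a | μ - 1 ≤ (X a : ℝ)} := by
        rw [prob, ← expect_mul_left, ← expect_const hw (μ - 1), ← expect_add, hμ]
        refine expect_mono hw fun a => ?_
        rw [expect_const hw, ← hμ]
        have : (X a : ℝ) ≤ B := by exact_mod_cast hXB a
        by_cases ha : μ - 1 ≤ (X a : ℝ)
        · simp only [Set.mem_ofPred_eq, ha, if_true]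
          linarith
        · simp only [Set.mem_ofPred_eq, ha, if_false]
          linarith
      have := prob_nonneg hw {a | μ - 1 ≤ (X a : ℝ)}
      linarith
    have h3 := prob_nonneg hw {a | (X a : ℝ) ≤ μ - 1 - t}
    have h4 := hexp (μ - 1) (by linarith) (by linarith)
    calc _ ≤ prob w {a | (X a : ℝ) ≤ μ - 1 - t} * ((B + 1) * prob w {a | μ - 1 ≤ (X a : ℝ)}) :=
          le_mul_of_one_le_right h3 h2
      _ = (B + 1) * (prob w {a | (X a : ℝ) ≤ μ - 1 - t} * prob w {a | μ - 1 ≤ (X a : ℝ)}) := by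
          ring
      _ ≤ _ := mul_le_mul_of_nonneg_left (h1.trans h4) (by linarith)
  have hup : prob w {a | ν + 1 + t ≤ (Y a : ℝ)} ≤
      (B + 1) * Real.exp (-(δ ^ 2 * M / 162)) := by
    have h1 := prob_mul_prob_le hw hY (show 0 ≤ ν + 1 by linarith) ht0
    have h2 : 1 ≤ (B + 1) * prob w {a | (Y a : ℝ) ≤ ν + 1} := by
      have h5 := mul_prob_le_expect hw (F := fun a => (Y a : ℝ)) (A := {a | (Y a : ℝ) ≤ ν + 1}ᶜ)
        (r := ν + 1) (fun a => Nat.cast_nonneg _) (fun a ha => (not_le.1 (show ¬ (Y a : ℝ) ≤ ν + 1 from ha)).le)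
      rw [prob_compl hw, ← hν] at h5
      have h6 : ν ≤ B := by
        rw [hν, ← expect_const hw (B : ℝ)]
        exact expect_mono hw fun a => by exact_mod_cast hYB a
      have h7 := prob_nonneg hw {a | (Y a : ℝ) ≤ ν + 1}
      nlinarith
    have h3 := prob_nonneg hw {a | ν + 1 + t ≤ (Y a : ℝ)}
    have h4 := hexp (ν + 1 + t) (by linarith) (by linarith)
    calc _ ≤ prob w {a | ν + 1 + t ≤ (Y a : ℝ)} * ((B + 1) * prob w {a | (Y a : ℝ) ≤ ν + 1}) :=
          le_mul_of_one_le_right h3 h2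
      _ = (B + 1) * (prob w {a | (Y a : ℝ) ≤ ν + 1} * prob w {a | ν + 1 + t ≤ (Y a : ℝ)}) := by
          ring
      _ ≤ _ := mul_le_mul_of_nonneg_left (h1.trans h4) (by linarith)
  calc _ ≤ prob w ({a | (X a : ℝ) ≤ μ - 1 - t} ∪ {a | ν + 1 + t ≤ (Y a : ℝ)}) := by
        refine prob_mono hw fun a ha => ?_
        have ha' : (X a : ℝ) - Y a ≤ μ - ν - 4 * t := ha
        by_contra hcon
        simp only [Set.mem_union, Set.mem_ofPred_eq, not_or, not_le] at hcon
        linarith [hcon.1, hcon.2]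
    _ ≤ _ := prob_union_le hw _ _
    _ ≤ _ := by linarith

/-- The number of colors in `S` that are assigned to a whole member of `𝓕`. -/
noncomputable def monoCount {κ C : Type*} (S : Finset C) (𝓕 : Set (Finset κ))
    (a : κ → Option C) : ℕ :=
  {c | c ∈ S ∧ ∃ T ∈ 𝓕, ∀ i ∈ T, a i = some c}.ncard

/-- Certify each counted color by one member of `𝓕` carrying it. If the color is lost, some
coordinate of that member changed. A coordinate carries only one color, so distinct lost colors use
distinct changed coordinates. -/
theorem certifiable_monoCount {κ C : Type*} (S : Finset C) {𝓕 : Set (Finset κ)}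
    (h𝓕 : ∀ T ∈ 𝓕, T.card ≤ 3) : Certifiable (monoCount S 𝓕) := by
  classical
  intro a
  have hfin : ∀ a : κ → Option C, {c | c ∈ S ∧ ∃ T ∈ 𝓕, ∀ i ∈ T, a i = some c}.Finite :=
    fun a => S.finite_toSet.subset fun c hc => hc.1
  choose! T hT𝓕 hT using fun c (hc : c ∈ {c | c ∈ S ∧ ∃ T ∈ 𝓕, ∀ i ∈ T, a i = some c}) => hc.2
  refine ⟨(hfin a).toFinset.biUnion T, ?_, fun b => ?_⟩
  · refine (Finset.card_biUnion_le_card_mul _ _ 3 fun c hc =>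
      h𝓕 _ (hT𝓕 c ((hfin a).mem_toFinset.1 hc))).trans ?_
    rw [monoCount, Set.ncard_eq_toFinset_card _ (hfin a), mul_comm]
  · set Q : Set κ := {i | i ∈ (hfin a).toFinset.biUnion T ∧ a i ≠ b i} with hQ
    have hQfin : Q.Finite := (Finset.finite_toSet _).subset fun i hi => hi.1
    have hsub : some '' {c | c ∈ S ∧ ∃ T ∈ 𝓕, ∀ i ∈ T, a i = some c} ⊆
        some '' {c | c ∈ S ∧ ∃ T ∈ 𝓕, ∀ i ∈ T, b i = some c} ∪ a '' Q := by
      rintro _ ⟨c, hc, rfl⟩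
      by_cases h : ∀ i ∈ T c, a i = b i
      · exact Or.inl ⟨c, ⟨hc.1, T c, hT𝓕 c hc, fun i hi => (h i hi) ▸ hT c hc i hi⟩, rfl⟩
      · push Not at h
        obtain ⟨i, hi, hne⟩ := h
        refine Or.inr ⟨i, ⟨?_, hne⟩, hT c hc i hi⟩
        exact Finset.mem_biUnion.2 ⟨c, (hfin a).mem_toFinset.2 hc, hi⟩
    have h1 := Set.ncard_le_ncard hsub (((hfin b).image _).union (hQfin.image _))
    have h2 := h1.trans (Set.ncard_union_le _ _)
    rw [Set.ncard_image_of_injective _ (Option.some_injective C),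
      Set.ncard_image_of_injective _ (Option.some_injective C)] at h2
    exact h2.trans (Nat.add_le_add_left (Set.ncard_image_le hQfin) _)

end FiniteProduct

/-! ### Antimatchings, Hall's theorem and list-critical graphs. -/

namespace SimpleGraph

variable {V C : Type*} [Fintype V] [DecidableEq V] [DecidableEq C]

/-- `φ` colors the vertices of `W` properly from the lists `L`. -/
def IsPartialColoring (G : SimpleGraph V) (L : V → Finset C) (W : Finset V) (φ : V → C) : Prop :=
  (∀ v ∈ W, φ v ∈ L v) ∧ ∀ u ∈ W, ∀ v ∈ W, G.Adj u v → φ u ≠ φ v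

theorem IsPartialColoring.listColorable {G : SimpleGraph V} {L : V → Finset C} {φ : V → C}
    (h : G.IsPartialColoring L Finset.univ φ) : G.ListColorable L :=
  ⟨Coloring.mk φ fun {u v} huv => h.2 u (Finset.mem_univ u) v (Finset.mem_univ v) huv,
    fun v => h.1 v (Finset.mem_univ v)⟩

/-- `M` is a matching, inside `H`, of the complement of `G`. -/
structure IsAntimatching (G : SimpleGraph V) (H : Finset V) (M : Finset (V × V)) : Prop where
  mem : ∀ p ∈ M, p.1 ∈ H ∧ p.2 ∈ H
  ne : ∀ p ∈ M, p.1 ≠ p.2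
  not_adj : ∀ p ∈ M, ¬ G.Adj p.1 p.2
  disjoint : ∀ p ∈ M, ∀ q ∈ M, p ≠ q → p.1 ≠ q.1 ∧ p.1 ≠ q.2 ∧ p.2 ≠ q.1 ∧ p.2 ≠ q.2

theorem IsAntimatching.subset {G : SimpleGraph V} {H : Finset V} {M M' : Finset (V × V)}
    (h : G.IsAntimatching H M) (hM : M' ⊆ M) : G.IsAntimatching H M' :=
  ⟨fun p hp => h.mem p (hM hp), fun p hp => h.ne p (hM hp), fun p hp => h.not_adj p (hM hp),
    fun p hp q hq => h.disjoint p (hM hp) q (hM hq)⟩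

theorem IsAntimatching.mono {G : SimpleGraph V} {H H' : Finset V} {M : Finset (V × V)}
    (h : G.IsAntimatching H M) (hH : H ⊆ H') : G.IsAntimatching H' M :=
  ⟨fun p hp => ⟨hH (h.mem p hp).1, hH (h.mem p hp).2⟩, h.ne, h.not_adj, h.disjoint⟩

/-- If no member of the antimatching `M` lies inside `S`, then `S` misses `M.card` vertices. -/
theorem IsAntimatching.card_add_card_le {G : SimpleGraph V} {H S : Finset V}
    {M : Finset (V × V)} (h : G.IsAntimatching H M) (hS : S ⊆ H)
    (hM : ∀ p ∈ M, ¬ (p.1 ∈ S ∧ p.2 ∈ S)) : S.card + M.card ≤ H.card := by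
  have h1 : M.card ≤ (H \ S).card := by
    refine Finset.card_le_card_of_injOn (fun p => if p.1 ∈ S then p.2 else p.1) ?_ ?_
    · intro p hp
      have h2 := hM p hp
      have h3 := h.mem p hp
      simp only [Finset.coe_sdiff, Set.mem_sdiff, Finset.mem_coe]
      split_ifs with h4
      · exact ⟨h3.2, fun h5 => h2 ⟨h4, h5⟩⟩
      · exact ⟨h3.1, h4⟩
    · intro p hp q hq hpq
      by_contra hne
      obtain ⟨h1, h2, h3, h4⟩ := h.disjoint p hp q hq hne
      dsimp only at hpq
      split_ifs at hpq <;> contradiction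
  have h2 := Finset.card_sdiff_add_card_eq_card hS
  omega

/-- Hall's condition gives all vertices of `H` different colors. A set containing a pair of `M` sees
two disjoint lists with at least |H| colors together. A set containing no pair has at most |H| − |M|
vertices, so one list of that size suffices; `hS` covers sets in which all lists are shorter. -/
theorem exists_coloring_of_disjoint_lists {G : SimpleGraph V} {H : Finset V} {L : V → Finset C}
    {M : Finset (V × V)} [Nonempty C] (hM : G.IsAntimatching H M)
    (hpair : ∀ p ∈ M, H.card ≤ (L p.1).card + (L p.2).card)
    (hS : ∀ S ⊆ H, S.Nonempty → (∀ u ∈ S, (L u).card + M.card < H.card) →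
      ∃ u ∈ S, S.card + M.card ≤ (L u).card)
    (hdisj : ∀ p ∈ M, Disjoint (L p.1) (L p.2)) :
    ∃ φ, G.IsPartialColoring L H φ := by
  have hall : ∀ S : Finset H, S.card ≤ (S.biUnion fun u => L u).card := by
    intro S'
    let S : Finset V := S'.map (Function.Embedding.subtype _)
    have hSH : S ⊆ H := by
      intro x hx
      obtain ⟨y, -, rfl⟩ := Finset.mem_map.1 hx
      exact y.2
    have hcard : S.card = S'.card := Finset.card_map _
    have hsub : ∀ u ∈ S, L u ⊆ S'.biUnion fun u => L u := by
      intro u hu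
      obtain ⟨y, hy, rfl⟩ := Finset.mem_map.1 hu
      exact Finset.subset_biUnion_of_mem (fun u : H => L u) hy
    rw [← hcard]
    by_cases hfull : ∃ p ∈ M, p.1 ∈ S ∧ p.2 ∈ S
    · obtain ⟨p, hp, h1, h2⟩ := hfull
      have h3 := Finset.card_le_card (Finset.union_subset (hsub _ h1) (hsub _ h2))
      rw [Finset.card_union_of_disjoint (hdisj p hp)] at h3
      exact ((Finset.card_le_card hSH).trans (hpair p hp)).trans h3
    push Not at hfull
    have hSM := hM.card_add_card_le hSH fun p hp h => hfull p hp h.1 h.2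
    by_cases hbig : ∃ u ∈ S, H.card ≤ (L u).card + M.card
    · obtain ⟨u, hu, h⟩ := hbig
      have := Finset.card_le_card (hsub u hu)
      omega
    push Not at hbig
    rcases S.eq_empty_or_nonempty with h0 | h0
    · simp [h0]
    · obtain ⟨u, hu, h⟩ := hS S hSH h0 hbig
      have := Finset.card_le_card (hsub u hu)
      omega
  obtain ⟨f, hf, hfL⟩ := (Finset.all_card_le_biUnion_card_iff_exists_injective _).1 hall
  refine ⟨fun v => if hv : v ∈ H then f ⟨v, hv⟩ else Classical.arbitrary C, fun v hv => ?_,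
    fun u hu v hv huv => ?_⟩
  · simpa [hv] using hfL ⟨v, hv⟩
  · simp only [hu, hv, dif_pos]
    intro h
    exact huv.ne (congrArg Subtype.val (hf h))

/-- Coloring from lists when the complement of `G` has a large matching inside `H`. -/
theorem exists_coloring_of_antimatching {G : SimpleGraph V} [Nonempty C] (m : ℕ) :
    ∀ (H : Finset V) (L : V → Finset C) (M : Finset (V × V)), M.card = m →
    G.IsAntimatching H M → (∀ p ∈ M, H.card ≤ (L p.1).card + (L p.2).card) →
    (∀ S ⊆ H, S.Nonempty → (∀ u ∈ S, (L u).card + m < H.card) →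
      ∃ u ∈ S, S.card + m ≤ (L u).card) →
    ∃ φ, G.IsPartialColoring L H φ := by
  induction m with
  | zero =>
    intro H L M hm hM hpair hS
    rw [Finset.card_eq_zero] at hm
    subst hm
    exact exists_coloring_of_disjoint_lists hM hpair (by simpa using hS) (by simp)
  | succ m ih =>
    intro H L M hm hM hpair hS
    by_cases hcommon : ∀ p ∈ M, Disjoint (L p.1) (L p.2)
    · exact exists_coloring_of_disjoint_lists hM hpair (by simpa [hm] using hS) hcommon
    push Not at hcommon
    obtain ⟨p, hp, hpd⟩ := hcommon
    obtain ⟨c, hc1, hc2⟩ := Finset.not_disjoint_iff.1 hpd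
    have hp1 := (hM.mem p hp).1
    have hp2 := (hM.mem p hp).2
    have hne := hM.ne p hp
    have hcard : ((H.erase p.1).erase p.2).card + 2 = H.card := by
      have h1 := Finset.card_erase_add_one hp1
      have h2 := Finset.card_erase_add_one (Finset.mem_erase.2 ⟨hne.symm, hp2⟩)
      omega
    have hL : ∀ u, (L u).card ≤ ((L u).erase c).card + 1 := fun u => by
      have := Finset.pred_card_le_card_erase (s := L u) (a := c)
      omega
    have hM' : G.IsAntimatching ((H.erase p.1).erase p.2) (M.erase p) := by
      refine ⟨fun q hq => ?_, (hM.subset (M.erase_subset p)).ne,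
        (hM.subset (M.erase_subset p)).not_adj, (hM.subset (M.erase_subset p)).disjoint⟩
      obtain ⟨hqp, hq⟩ := Finset.mem_erase.1 hq
      obtain ⟨h1, h2, h3, h4⟩ := hM.disjoint q hq p hp hqp
      have h5 := hM.mem q hq
      simp [h1, h2, h3, h4, h5]
    -- Give the common color `c` to both ends of `p` and delete it everywhere. Then |H| drops by
    -- two, each list by at most one and the matching by one, so both numerical conditions persist.
    obtain ⟨φ, hφL, hφ⟩ := ih ((H.erase p.1).erase p.2) (fun u => (L u).erase c) (M.erase p)
      (by rw [Finset.card_erase_of_mem hp, hm]; rfl) hM' (by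
        intro q hq
        have h1 := hpair q (Finset.mem_of_mem_erase hq)
        have h2 := hL q.1
        have h3 := hL q.2
        omega) (by
        intro S hSH hSne hSu
        obtain ⟨u, hu, h⟩ := hS S (hSH.trans ((Finset.erase_subset _ _).trans
          (Finset.erase_subset _ _))) hSne (by
            intro u hu
            have h1 := hSu u hu
            have h2 := hL u
            omega)
        have h2 := hL u
        exact ⟨u, hu, by omega⟩)
    have hmem : ∀ v ∈ H, v ≠ p.1 → v ≠ p.2 → v ∈ (H.erase p.1).erase p.2 := by
      intro v hv h1 h2
      simp [hv, h1, h2]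
    have hcφ : ∀ v ∈ H, v ≠ p.1 → v ≠ p.2 → φ v ≠ c := fun v hv h1 h2 =>
      (Finset.mem_erase.1 (hφL v (hmem v hv h1 h2))).1
    refine ⟨fun v => if v = p.1 ∨ v = p.2 then c else φ v, fun v hv => ?_, fun u hu v hv huv => ?_⟩
    · by_cases h1 : v = p.1
      · simpa [h1] using hc1
      by_cases h2 : v = p.2
      · simpa [h2] using hc2
      simpa [h1, h2] using (Finset.mem_erase.1 (hφL v (hmem v hv h1 h2))).2
    · have hnadj := hM.not_adj p hp
      by_cases hu' : u = p.1 ∨ u = p.2 <;> by_cases hv' : v = p.1 ∨ v = p.2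
      · rcases hu' with rfl | rfl <;> rcases hv' with rfl | rfl
        · exact (huv.ne rfl).elim
        · exact (hnadj huv).elim
        · exact (hnadj huv.symm).elim
        · exact (huv.ne rfl).elim
      · simp only [hu', hv', if_true, if_false]
        push Not at hv'
        exact (hcφ v hv hv'.1 hv'.2).symm
      · simp only [hu', hv', if_true, if_false]
        push Not at hu'
        exact hcφ u hu hu'.1 hu'.2
      · simp only [hu', hv', if_false]
        push Not at hu' hv'
        exact hφ u (hmem u hu hu'.1 hu'.2) v (hmem v hv hv'.1 hv'.2) huv

theorem card_le_cliqueNumAt {G : SimpleGraph V} {v : V} {s : Finset V} (hs : G.IsClique s)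
    (hv : v ∈ s) : s.card ≤ G.cliqueNumAt v :=
  (G.isGreatest_cliqueNumAt v).2 ⟨s, ⟨hs, rfl⟩, hv⟩

/-- A maximal antimatching of the neighborhood of `v` leaves a clique. -/
theorem exists_antimatching {G : SimpleGraph V} {v : V} {H : Finset V} (hv : v ∈ H)
    (hH : ∀ u ∈ H, u ≠ v → G.Adj v u) :
    ∃ M, G.IsAntimatching H M ∧ H.card ≤ 2 * M.card + G.cliqueNumAt v := by
  classical
  -- The maximum is taken inside `H.erase v`, so `v` stays uncovered and the clique of uncovered
  -- vertices contains it.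
  obtain ⟨M, hM, hmax⟩ := Finset.exists_max_image
    (Finset.univ.filter fun M : Finset (V × V) => G.IsAntimatching (H.erase v) M) Finset.card
    ⟨∅, by simp only [Finset.mem_filter, Finset.mem_univ, true_and]; constructor <;> simp⟩
  simp only [Finset.mem_filter, Finset.mem_univ, true_and] at hM hmax
  refine ⟨M, hM.mono (H.erase_subset v), ?_⟩
  set P : Finset V := M.image Prod.fst ∪ M.image Prod.snd with hP
  have hPcard : P.card ≤ 2 * M.card := by
    rw [hP]
    have h1 := Finset.card_union_le (M.image Prod.fst) (M.image Prod.snd)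
    have h2 : (M.image Prod.fst).card ≤ M.card := Finset.card_image_le
    have h3 : (M.image Prod.snd).card ≤ M.card := Finset.card_image_le
    omega
  have hP1 : ∀ p ∈ M, p.1 ∈ P ∧ p.2 ∈ P := fun p hp =>
    ⟨Finset.mem_union_left _ (Finset.mem_image_of_mem _ hp),
      Finset.mem_union_right _ (Finset.mem_image_of_mem _ hp)⟩
  have hvP : v ∉ P := by
    intro h
    simp only [hP, Finset.mem_union, Finset.mem_image] at h
    rcases h with ⟨p, hp, rfl⟩ | ⟨p, hp, rfl⟩
    · exact (Finset.mem_erase.1 (hM.mem p hp).1).1 rfl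
    · exact (Finset.mem_erase.1 (hM.mem p hp).2).1 rfl
  have hclique : G.IsClique ((H \ P : Finset V) : Set V) := by
    intro x hx y hy hxy
    simp only [Finset.coe_sdiff, Set.mem_sdiff, Finset.mem_coe] at hx hy
    by_cases hxv : x = v
    · exact hxv ▸ hH y hy.1 (fun h => hxy (hxv.trans h.symm))
    by_cases hyv : y = v
    · exact hyv ▸ (hH x hx.1 hxv).symm
    by_contra hnadj
    have hxyM : (x, y) ∉ M := fun h => hx.2 (hP1 _ h).1
    have hnew : G.IsAntimatching (H.erase v) (insert (x, y) M) := by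
      have hd : ∀ q ∈ M, x ≠ q.1 ∧ x ≠ q.2 ∧ y ≠ q.1 ∧ y ≠ q.2 := by
        intro q hq
        obtain ⟨h1, h2⟩ := hP1 q hq
        exact ⟨fun h => hx.2 (h ▸ h1), fun h => hx.2 (h ▸ h2), fun h => hy.2 (h ▸ h1),
          fun h => hy.2 (h ▸ h2)⟩
      refine ⟨?_, ?_, ?_, ?_⟩
      · intro p hp
        rcases Finset.mem_insert.1 hp with rfl | hp
        · exact ⟨Finset.mem_erase.2 ⟨hxv, hx.1⟩, Finset.mem_erase.2 ⟨hyv, hy.1⟩⟩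
        · exact hM.mem p hp
      · intro p hp
        rcases Finset.mem_insert.1 hp with rfl | hp
        · exact hxy
        · exact hM.ne p hp
      · intro p hp
        rcases Finset.mem_insert.1 hp with rfl | hp
        · exact hnadj
        · exact hM.not_adj p hp
      · intro p hp q hq hpq
        rcases Finset.mem_insert.1 hp with rfl | hp <;> rcases Finset.mem_insert.1 hq with rfl | hq
        · exact (hpq rfl).elim
        · exact hd q hq
        · obtain ⟨h1, h2, h3, h4⟩ := hd p hp
          exact ⟨h1.symm, h3.symm, h2.symm, h4.symm⟩
        · exact hM.disjoint p hp q hq hpq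
    have := hmax _ hnew
    rw [Finset.card_insert_of_notMem hxyM] at this
    omega
  have h1 := card_le_cliqueNumAt hclique (Finset.mem_sdiff.2 ⟨hv, hvP⟩)
  have h2 := Finset.card_le_card_sdiff_add_card (s := H) (t := P)
  omega

variable (G : SimpleGraph V) [DecidableRel G.Adj]

/-- The vertices of `H` that are distinct from `u` and not adjacent to `u`. -/
def nonNbr (H : Finset V) (u : V) : Finset V := H.filter fun x => x ≠ u ∧ ¬ G.Adj u x

theorem degree_in_add_nonNbr {H : Finset V} {u : V} (hu : u ∈ H) :
    (H.filter (G.Adj u)).card + (G.nonNbr H u).card + 1 = H.card := by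
  have h1 : H.filter (G.Adj u) ∪ G.nonNbr H u = H.erase u := by
    ext x
    simp only [nonNbr, Finset.mem_union, Finset.mem_filter, Finset.mem_erase]
    constructor
    · rintro (⟨h, h'⟩ | ⟨h, h', -⟩)
      · exact ⟨h'.ne', h⟩
      · exact ⟨h', h⟩
    · rintro ⟨h, h'⟩
      by_cases hux : G.Adj u x
      · exact Or.inl ⟨h', hux⟩
      · exact Or.inr ⟨h', h, hux⟩
  have h2 : Disjoint (H.filter (G.Adj u)) (G.nonNbr H u) := by
    rw [Finset.disjoint_left]
    intro x hx hx'
    exact (Finset.mem_filter.1 hx').2.2 (Finset.mem_filter.1 hx).2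
  rw [← Finset.card_union_of_disjoint h2, h1, Finset.card_erase_add_one hu]

/-- The number of ordered pairs of distinct nonadjacent vertices of `H`. -/
def numNonAdj (H : Finset V) : ℕ := ∑ u ∈ H, (G.nonNbr H u).card

theorem numNonAdj_erase {H : Finset V} {u : V} (hu : u ∈ H) :
    G.numNonAdj (H.erase u) + 2 * (G.nonNbr H u).card = G.numNonAdj H := by
  have h1 : ∀ x ∈ H.erase u, (G.nonNbr H x).card =
      (G.nonNbr (H.erase u) x).card + if x ∈ G.nonNbr H u then 1 else 0 := by
    intro x hx
    obtain ⟨hxu, hxH⟩ := Finset.mem_erase.1 hx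
    have h2 : G.nonNbr (H.erase u) x = (G.nonNbr H x).erase u := by
      ext y
      simp only [nonNbr, Finset.mem_filter, Finset.mem_erase]
      tauto
    rw [h2]
    by_cases hux : G.Adj u x
    · have h3 : u ∉ G.nonNbr H x := fun h => (Finset.mem_filter.1 h).2.2 hux.symm
      have h4 : x ∉ G.nonNbr H u := fun h => (Finset.mem_filter.1 h).2.2 hux
      simp [h3, h4]
    · have h3 : u ∈ G.nonNbr H x :=
        Finset.mem_filter.2 ⟨hu, hxu.symm, fun h => hux h.symm⟩
      have h4 : x ∈ G.nonNbr H u := Finset.mem_filter.2 ⟨hxH, hxu, hux⟩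
      simp [h4, Finset.card_erase_add_one h3]
  have h5 : ((H.erase u).filter fun x => x ∈ G.nonNbr H u) = G.nonNbr H u := by
    ext x
    simp only [nonNbr, Finset.mem_filter, Finset.mem_erase]
    tauto
  rw [numNonAdj, numNonAdj, ← Finset.add_sum_erase H _ hu, Finset.sum_congr rfl h1,
    Finset.sum_add_distrib, Finset.sum_boole, h5]
  simp only [Nat.cast_id]
  ring

/-- Every proper induced subgraph is colorable from `L`, but the whole graph is not. -/
structure IsListCritical (L : V → Finset C) : Prop where
  not_colorable : ¬ G.ListColorable L
  compl_colorable : ∀ H : Finset V, H.Nonempty → ∃ φ, G.IsPartialColoring L Hᶜ φ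

variable {G} {L : V → Finset C}

/-- Color the complement of `H` and delete from each list the colors used on outside neighbors. The
remaining lists cannot color `H`, and u has lost at most as many colors as it has neighbors outside
`H`. -/
theorem IsListCritical.exists_lists (h : G.IsListCritical L) {H : Finset V} (hH : H.Nonempty) :
    ∃ L' : V → Finset C, (∀ u ∈ H, (L u).card + H.card ≤
        (L' u).card + G.degree u + 1 + (G.nonNbr H u).card) ∧
      ¬ ∃ φ, G.IsPartialColoring L' H φ := by
  obtain ⟨φ, hφL, hφ⟩ := h.compl_colorable H hH
  refine ⟨fun u => L u \ ((G.neighborFinset u \ H).image φ), fun u hu => ?_, ?_⟩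
  · have h1 := Finset.le_card_sdiff ((G.neighborFinset u \ H).image φ) (L u)
    have h2 : ((G.neighborFinset u \ H).image φ).card ≤ (G.neighborFinset u \ H).card :=
      Finset.card_image_le
    have h3 : (H.filter (G.Adj u)).card + (G.neighborFinset u \ H).card = G.degree u := by
      have : H.filter (G.Adj u) = G.neighborFinset u ∩ H := by
        ext x
        simp [and_comm]
      rw [this, Finset.card_inter_add_card_sdiff, card_neighborFinset_eq_degree]
    have h4 := G.degree_in_add_nonNbr hu
    dsimp only
    omega
  · rintro ⟨ψ, hψL, hψ⟩
    refine h.not_colorable (IsPartialColoring.listColorable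
      (φ := fun v => if v ∈ H then ψ v else φ v) ⟨fun v _ => ?_, fun u _ v _ huv => ?_⟩)
    · by_cases hv : v ∈ H
      · simpa [hv] using (Finset.mem_sdiff.1 (hψL v hv)).1
      · simpa [hv] using hφL v (Finset.mem_compl.2 hv)
    · have key : ∀ u ∈ H, ∀ v ∉ H, G.Adj u v → ψ u ≠ φ v := by
        intro u hu v hv huv heq
        refine (Finset.mem_sdiff.1 (hψL u hu)).2 (heq ▸ Finset.mem_image_of_mem φ ?_)
        simp [huv, hv]
      by_cases hu : u ∈ H <;> by_cases hv : v ∈ H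
      · simpa [hu, hv] using hψ u hu v hv huv
      · simpa [hu, hv] using key u hu v hv huv
      · simpa [hu, hv] using (key v hv u hu huv.symm).symm
      · simpa [hu, hv] using hφ u (Finset.mem_compl.2 hu) v (Finset.mem_compl.2 hv) huv

theorem IsListCritical.card_le_degree (h : G.IsListCritical L) (v : V) :
    (L v).card ≤ G.degree v := by
  by_contra hlt
  obtain ⟨L', hL', hnot⟩ := h.exists_lists (Finset.singleton_nonempty v)
  have h1 := hL' v (Finset.mem_singleton_self v)
  have h2 : G.nonNbr {v} v = ∅ := by
    ext x
    simp +contextual [nonNbr]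
  rw [h2, Finset.card_empty, Finset.card_singleton] at h1
  obtain ⟨c, hc⟩ := Finset.card_pos.1 (show 0 < (L' v).card by omega)
  refine hnot ⟨fun _ => c, fun u hu => ?_, fun u hu w hw huw => ?_⟩
  · rwa [Finset.mem_singleton.1 hu]
  · rw [Finset.mem_singleton.1 hu, Finset.mem_singleton.1 hw] at huw
    exact (huw.ne rfl).elim

end SimpleGraph

/-! ### Neighborhoods in critical graphs and the three sources of savings. -/

namespace SimpleGraph

variable {V C : Type*} [Fintype V] [DecidableEq V] [DecidableEq C]
variable (G : SimpleGraph V) [DecidableRel G.Adj] (L : V → Finset C)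

/-- The amount by which the list of `v` is smaller than `d(v) + 1`. -/
def save (v : V) : ℝ := G.degree v + 1 - (L v).card

/-- The gap between `d(v) + 1` and `ω(v)`. -/
noncomputable def gap (v : V) : ℝ := G.degree v + 1 - G.cliqueNumAt v

/-- The neighbors of `v` whose lists are at least as long as the list of `v`. -/
def up (v : V) : Finset V := (G.neighborFinset v).filter fun u => (L v).card ≤ (L u).card

/-- The neighbors of `v` whose lists are shorter than the list of `v`. -/
def down (v : V) : Finset V := (G.neighborFinset v).filter fun u => (L u).card < (L v).card

/-- The sum, over the neighbors in `up v`, of the proportion of the list outside `L v`. -/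
noncomputable def outsideMass (v : V) : ℝ :=
  ∑ u ∈ G.up L v, ((L u \ L v).card : ℝ) / (L u).card

/-- The neighbors in `up v` whose lists lie mostly inside `L v`. -/
def similar (v : V) : Finset V := (G.up L v).filter fun u => 10 * (L u \ L v).card ≤ (L u).card

/-- The list sizes interpolate between the degree bound and the clique bound. -/
def HasLongLists : Prop := ∀ v, (1 - 1 / 330 : ℝ) * ((G.degree v : ℝ) + 1) +
  (1 / 330 : ℝ) * (G.cliqueNumAt v : ℝ) ≤ ((L v).card : ℝ)

variable {G L}

theorem up_subset (v : V) : G.up L v ⊆ G.neighborFinset v := Finset.filter_subset _ _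

theorem mem_up {u v : V} : u ∈ G.up L v ↔ G.Adj v u ∧ (L v).card ≤ (L u).card := by
  simp [up]

theorem mem_down {u v : V} : u ∈ G.down L v ↔ G.Adj v u ∧ (L u).card < (L v).card := by
  simp [down]

theorem mem_similar {u v : V} :
    u ∈ G.similar L v ↔ u ∈ G.up L v ∧ 10 * (L u \ L v).card ≤ (L u).card := by
  simp [similar]

theorem card_up_add_card_down (v : V) : (G.up L v).card + (G.down L v).card = G.degree v := by
  have : G.down L v = (G.neighborFinset v).filter fun u => ¬ (L v).card ≤ (L u).card := by
    simp [down]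
  rw [this, up, Finset.card_filter_add_card_filter_not, card_neighborFinset_eq_degree]

theorem card_le_card_add_card_sdiff (u v : V) :
    ((L u).card : ℝ) ≤ (L v).card + (L u \ L v).card := by
  have := Finset.card_le_card_sdiff_add_card (s := L u) (t := L v)
  rw [add_comm]
  exact_mod_cast this

theorem numNonAdj_mono {H H' : Finset V} (h : H ⊆ H') : G.numNonAdj H ≤ G.numNonAdj H' := by
  refine (Finset.sum_le_sum fun u _ => ?_).trans (Finset.sum_le_sum_of_subset h)
  exact Finset.card_le_card (Finset.filter_subset_filter _ h)

theorem nonNbr_self {v : V} {H : Finset V} (hH : ∀ u ∈ H, u ≠ v → G.Adj v u) :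
    G.nonNbr H v = ∅ := by
  rw [nonNbr, Finset.filter_eq_empty_iff]
  exact fun u hu h => h.2 (hH u hu h.1)

theorem numNonAdj_erase_self {v : V} {H : Finset V} (hv : v ∈ H)
    (hH : ∀ u ∈ H, u ≠ v → G.Adj v u) : G.numNonAdj (H.erase v) = G.numNonAdj H := by
  have := G.numNonAdj_erase hv
  rwa [nonNbr_self hH, Finset.card_empty, mul_zero, add_zero] at this

/-- In a critical graph a neighborhood with few nonadjacent pairs meets an obstruction. -/
theorem IsListCritical.exists_obstruction (h : G.IsListCritical L) {v : V} {H : Finset V}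
    (hv : v ∈ H) (hH : ∀ u ∈ H, u ≠ v → G.Adj v u) {m : ℕ}
    (hm : 2 * m + G.cliqueNumAt v ≤ H.card + 1) :
    (∃ u ∈ H, (H.card : ℝ) < 2 * ((G.nonNbr H u).card + G.save L u)) ∨
    ∃ S ⊆ H, S.Nonempty ∧ ∀ u ∈ S, (m : ℝ) < (G.nonNbr H u).card + G.save L u ∧
      (H.card : ℝ) < (G.nonNbr H u).card + G.save L u + S.card + m := by
  by_contra! hcon
  obtain ⟨hpair, hS⟩ := hcon
  obtain ⟨L', hL', hnot⟩ := h.exists_lists (H := H) ⟨v, hv⟩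
  obtain ⟨M, hM, hMcard⟩ := exists_antimatching hv hH
  -- The slack `+ 1` in `hm` is harmless: 2m ≤ 2|M| + 1 still forces m ≤ |M|.
  obtain ⟨M', hM'M, hM'⟩ := Finset.exists_subset_card_eq (s := M) (n := m) (by omega)
  have hlow : ∀ u ∈ H, (H.card : ℝ) ≤ (L' u).card + ((G.nonNbr H u).card + G.save L u) := by
    intro u hu
    have h1 : ((L u).card : ℝ) + H.card ≤
        (L' u).card + G.degree u + 1 + (G.nonNbr H u).card := by exact_mod_cast hL' u hu
    rw [save]
    linarith
  have hC : Nonempty C := by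
    by_contra hC
    rw [not_nonempty_iff] at hC
    have h1 := hpair v hv
    have h2 := hlow v hv
    have h3 : (L' v).card = 0 := by simp [Finset.eq_empty_of_isEmpty]
    have h4 : (0 : ℝ) < H.card := by exact_mod_cast Finset.card_pos.2 ⟨v, hv⟩
    rw [h3, Nat.cast_zero] at h2
    linarith
  refine hnot (exists_coloring_of_antimatching m H L' M' hM' (hM.subset hM'M) ?_ ?_)
  · intro p hp
    obtain ⟨hp1, hp2⟩ := (hM.subset hM'M).mem p hp
    have h1 := hlow _ hp1
    have h2 := hlow _ hp2
    have h3 := hpair _ hp1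
    have h4 := hpair _ hp2
    have : (H.card : ℝ) ≤ (L' p.1).card + (L' p.2).card := by linarith
    exact_mod_cast this
  · intro S hSH hSne hSu
    obtain ⟨u, hu, hmu⟩ := hS S hSH hSne
    have h1 := hlow u (hSH hu)
    have h2 : ((L' u).card : ℝ) + m < H.card := by exact_mod_cast hSu u hu
    have h3 := hmu (by linarith)
    have h4 : (S.card : ℝ) + m ≤ (L' u).card := by linarith
    exact ⟨u, hu, by exact_mod_cast h4⟩

/-- With m = ⌈(|H| − ω(v))/2⌉ either obstruction supplies such a vertex. When |H| < ω(v) the left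
side is negative and `v` itself serves. -/
theorem IsListCritical.exists_many_nonNbr (h : G.IsListCritical L) {v : V} {H : Finset V}
    (hv : v ∈ H) (hH : ∀ u ∈ H, u ≠ v → G.Adj v u) :
    ∃ u ∈ H, ((H.card : ℝ) - G.cliqueNumAt v) / 2 < (G.nonNbr H u).card + G.save L u := by
  rcases lt_or_ge H.card (G.cliqueNumAt v) with hlt | hge
  · refine ⟨v, hv, ?_⟩
    have h1 := h.card_le_degree v
    have h2 : ((L v).card : ℝ) ≤ G.degree v := by exact_mod_cast h1
    have h3 : (H.card : ℝ) < G.cliqueNumAt v := by exact_mod_cast hlt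
    have h4 : (0 : ℝ) ≤ (G.nonNbr H v).card := Nat.cast_nonneg _
    rw [save]
    linarith
  obtain ⟨m, hm1, hm2⟩ : ∃ m, 2 * m + G.cliqueNumAt v ≤ H.card + 1 ∧
      H.card ≤ 2 * m + G.cliqueNumAt v := ⟨(H.card + 1 - G.cliqueNumAt v) / 2, by omega, by omega⟩
  have hm3 : (H.card : ℝ) ≤ 2 * m + G.cliqueNumAt v := by exact_mod_cast hm2
  rcases h.exists_obstruction hv hH hm1 with ⟨u, hu, hlt⟩ | ⟨S, hSH, ⟨u, hu⟩, hS⟩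
  · refine ⟨u, hu, ?_⟩
    have : (0 : ℝ) ≤ G.cliqueNumAt v := Nat.cast_nonneg _
    linarith
  · exact ⟨u, hSH hu, by linarith [(hS u hu).1]⟩

/-- Delete vertices from `exists_many_nonNbr` one at a time. With x = |H| − ω(v), each deletion
removes more than x − 2s ordered pairs, and summing over decreasing x gives the quadratic. For x ≤
4s the bound is not positive. -/
theorem IsListCritical.le_numNonAdj (h : G.IsListCritical L) {v : V} {s : ℝ} (hs : 0 ≤ s) (n : ℕ) :
    ∀ H : Finset V, H.card = n → v ∈ H → (∀ u ∈ H, u ≠ v → G.Adj v u) →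
    (∀ u ∈ H, G.save L u ≤ s) → G.cliqueNumAt v ≤ H.card →
    ((H.card : ℝ) - G.cliqueNumAt v) ^ 2 / 2 - 2 * s * (H.card - G.cliqueNumAt v) ≤
      G.numNonAdj H := by
  induction n with
  | zero =>
    intro H hn hv
    exact absurd (Finset.card_pos.2 ⟨v, hv⟩) (by omega)
  | succ n ih =>
    intro H hn hv hH hsave hω
    have hω' : (G.cliqueNumAt v : ℝ) ≤ H.card := by exact_mod_cast hω
    have h0 : (0 : ℝ) ≤ G.numNonAdj H := Nat.cast_nonneg _
    rcases le_or_gt ((H.card : ℝ) - G.cliqueNumAt v) (4 * s) with hle | hgt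
    · nlinarith
    obtain ⟨u, hu, hlt⟩ := h.exists_many_nonNbr hv hH
    have h1 := hsave u hu
    have huv : v ≠ u := by
      rintro rfl
      rw [nonNbr_self hH, Finset.card_empty, Nat.cast_zero] at hlt
      linarith
    have hω1 : G.cliqueNumAt v < H.card := by
      have : (G.cliqueNumAt v : ℝ) < H.card := by linarith
      exact_mod_cast this
    have hc := Finset.card_erase_add_one hu
    have hc' : ((H.erase u).card : ℝ) + 1 = H.card := by exact_mod_cast hc
    have h2 := ih (H.erase u) (by omega) (Finset.mem_erase.2 ⟨huv, hv⟩)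
      (fun x hx => hH x (Finset.mem_of_mem_erase hx))
      (fun x hx => hsave x (Finset.mem_of_mem_erase hx)) (by omega)
    have h3 : (G.numNonAdj (H.erase u) : ℝ) + 2 * (G.nonNbr H u).card = G.numNonAdj H := by
      exact_mod_cast G.numNonAdj_erase hu
    have h4 : ((H.erase u).card : ℝ) = H.card - 1 := by linarith
    rw [h4] at h2
    nlinarith

/-- Vertices with many nonneighbors can be removed one by one. -/
theorem exists_subset_few_nonNbr {v : V} {r : ℝ} (hr : 0 ≤ r) (n : ℕ) :
    ∀ H : Finset V, H.card = n → v ∈ H → (∀ u ∈ H, u ≠ v → G.Adj v u) →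
    ∃ H' ⊆ H, v ∈ H' ∧ (∀ u ∈ H', ((G.nonNbr H' u).card : ℝ) ≤ r) ∧
      2 * r * ((H.card : ℝ) - H'.card) ≤ G.numNonAdj H := by
  induction n with
  | zero =>
    intro H hn hv
    exact absurd (Finset.card_pos.2 ⟨v, hv⟩) (by omega)
  | succ n ih =>
    intro H hn hv hH
    by_cases hall : ∀ u ∈ H, ((G.nonNbr H u).card : ℝ) ≤ r
    · exact ⟨H, Finset.Subset.refl _, hv, hall, by simp⟩
    push Not at hall
    obtain ⟨u, hu, hur⟩ := hall
    have huv : v ≠ u := by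
      rintro rfl
      rw [nonNbr_self hH, Finset.card_empty, Nat.cast_zero] at hur
      linarith
    have hc := Finset.card_erase_add_one hu
    have hc' : ((H.erase u).card : ℝ) + 1 = H.card := by exact_mod_cast hc
    obtain ⟨H', hH', hvH', hall', hcount⟩ := ih (H.erase u) (by omega)
      (Finset.mem_erase.2 ⟨huv, hv⟩) (fun x hx => hH x (Finset.mem_of_mem_erase hx))
    have h3 : (G.numNonAdj (H.erase u) : ℝ) + 2 * (G.nonNbr H u).card = G.numNonAdj H := by
      exact_mod_cast G.numNonAdj_erase hu
    refine ⟨H', hH'.trans (H.erase_subset u), hvH', hall', ?_⟩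
    rw [← hc']
    linarith

/-- Restrict a largest clique at v to the neighbors of u and add u. The only vertices lost are
nonneighbors of u in `H` and vertices of N[v] outside `H`. Thus a vertex with few nonneighbors has
large ω, which by `save_le` limits its save. -/
theorem cliqueNumAt_le_add (u : V) {v : V} {H : Finset V}
    (hH : ∀ x ∈ H, x = v ∨ G.Adj v x) :
    G.cliqueNumAt v + H.card ≤ G.cliqueNumAt u + (G.nonNbr H u).card + G.degree v + 1 := by
  obtain ⟨K, hK, hvK⟩ := (G.isGreatest_cliqueNumAt v).1
  set N := insert v (G.neighborFinset v) with hN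
  have hKN : K ⊆ N := by
    intro x hx
    by_cases hxv : x = v
    · simp [hN, hxv]
    · simpa [hN, hxv] using hK.1 hvK hx (Ne.symm hxv)
  have hHN : H ⊆ N := by
    intro x hx
    simpa [hN] using hH x hx
  have hNcard : N.card = G.degree v + 1 := by
    rw [hN, Finset.card_insert_of_notMem (by simp), card_neighborFinset_eq_degree]
  set K' := insert u (K.filter (G.Adj u)) with hK'
  have hclique : G.IsClique (K' : Set V) := by
    rw [hK', Finset.coe_insert, isClique_insert]
    refine ⟨hK.1.subset fun x hx => (Finset.mem_filter.1 (Finset.mem_coe.1 hx)).1, fun x hx _ => ?_⟩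
    exact (Finset.mem_filter.1 hx).2
  have h1 := card_le_cliqueNumAt hclique (Finset.mem_insert_self u _)
  have h2 : K ⊆ K' ∪ (G.nonNbr H u ∪ (N \ H)) := by
    intro x hx
    by_cases hxu : x = u
    · simp [hK', hxu]
    by_cases hadj : G.Adj u x
    · simp [hK', hx, hadj]
    by_cases hxH : x ∈ H
    · simp [nonNbr, hxH, hxu, hadj]
    · simp [hKN hx, hxH]
  have h3 := Finset.card_le_card h2
  have h4 := Finset.card_union_le K' (G.nonNbr H u ∪ (N \ H))
  have h5 := Finset.card_union_le (G.nonNbr H u) (N \ H)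
  have h6 := Finset.card_sdiff_add_card_eq_card hHN
  rw [hK.2] at h3
  omega

theorem save_le (hL : G.HasLongLists L) (u : V) : 329 * G.save L u ≤ (L u).card - G.cliqueNumAt u := by
  have := hL u
  rw [save]
  linarith

theorem save_le_card (hL : G.HasLongLists L) (u : V) : 329 * G.save L u ≤ (L u).card :=
  (save_le hL u).trans (sub_le_self _ (Nat.cast_nonneg _))

theorem save_le_gap (hL : G.HasLongLists L) (u : V) : 330 * G.save L u ≤ G.gap u := by
  have := hL u
  rw [save, gap]
  linarith

theorem outsideMass_term_nonneg (u v : V) : 0 ≤ ((L u \ L v).card : ℝ) / (L u).card := by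
  positivity

/-- Since |L(u)| ≤ |L(v)| + |L(u) \ L(v)| and x/(|L(v)| + x) increases in x, each vertex of `S`
contributes at least t/(|L(v)| + t). -/
theorem card_mul_le_outsideMass {v : V} {t : ℝ} {S : Finset V} (ht : 0 < t)
    (hv : 0 < (L v).card) (hS : S ⊆ G.up L v) (hSt : ∀ u ∈ S, t ≤ (L u \ L v).card) :
    (S.card : ℝ) * t ≤ G.outsideMass L v * ((L v).card + t) := by
  have hl : (0 : ℝ) < (L v).card := by exact_mod_cast hv
  have h1 : (S.card : ℝ) * (t / ((L v).card + t)) ≤ G.outsideMass L v := by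
    rw [← nsmul_eq_mul]
    refine (Finset.card_nsmul_le_sum _ (fun u => ((L u \ L v).card : ℝ) / (L u).card) _
      fun u hu => ?_).trans (Finset.sum_le_sum_of_subset_of_nonneg hS
        fun u _ _ => outsideMass_term_nonneg u v)
    have h2 := card_le_card_add_card_sdiff (L := L) u v
    have h3 : ((L v).card : ℝ) ≤ (L u).card := Nat.cast_le.2 (mem_up.1 (hS hu)).2
    have h4 := mul_le_mul_of_nonneg_right (hSt u hu) hl.le
    rw [div_le_div_iff₀ (by linarith) (by linarith)]
    nlinarith
  rwa [← mul_div_assoc, div_le_iff₀ (by linarith)] at h1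

/-- Each neighbor in `up v` that is not similar contributes more than 1/10 to the outside mass. -/
theorem degree_le_card_similar {v : V} (hv : 0 < (L v).card) :
    (G.degree v : ℝ) ≤ (G.similar L v).card + 10 * G.outsideMass L v + (G.down L v).card := by
  have h1 : ((((G.up L v).filter fun u => ¬ 10 * (L u \ L v).card ≤ (L u).card).card : ℝ)) *
      (1 / 10) ≤ G.outsideMass L v := by
    rw [← nsmul_eq_mul]
    refine (Finset.card_nsmul_le_sum _ (fun u => ((L u \ L v).card : ℝ) / (L u).card) _
      fun u hu => ?_).trans (Finset.sum_le_sum_of_subset_of_nonneg (Finset.filter_subset _ _)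
        fun u _ _ => outsideMass_term_nonneg u v)
    obtain ⟨hu, hlt⟩ := Finset.mem_filter.1 hu
    have h2 : ((L u).card : ℝ) < 10 * (L u \ L v).card := by exact_mod_cast not_le.1 hlt
    have h3 : (0 : ℝ) < (L u).card := by exact_mod_cast hv.trans_le (mem_up.1 hu).2
    rw [le_div_iff₀ h3]
    linarith
  have h2 := Finset.card_filter_add_card_filter_not (s := G.up L v)
    (fun u => 10 * (L u \ L v).card ≤ (L u).card)
  have h3 := card_up_add_card_down (G := G) (L := L) v
  have h4 : (((G.similar L v).card : ℝ) +
      ((G.up L v).filter fun u => ¬ 10 * (L u \ L v).card ≤ (L u).card).card) +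
        (G.down L v).card = G.degree v := by
    rw [← h3, ← h2]
    push_cast
    rfl
  linarith

theorem save_le_of_mem_similar (hL : G.HasLongLists L) {u v : V} (hu : u ∈ G.similar L v) :
    296 * G.save L u ≤ (L v).card := by
  have h1 := save_le_card hL u
  have h2 := (mem_similar.1 hu).2
  have h3 := card_le_card_add_card_sdiff (L := L) u v
  have h4 : (10 : ℝ) * (L u \ L v).card ≤ (L u).card := by exact_mod_cast h2
  linarith

/-- The neighborhood of `v` in a critical graph has many nonadjacent pairs: large gap. -/
theorem IsListCritical.gap_le_degree (h : G.IsListCritical L) {v : V}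
    {E : Finset V} (hvE : v ∈ E) (hE : ∀ u ∈ E, u ≠ v → G.Adj v u)
    (hEsave : ∀ u ∈ E, G.save L u ≤ 0.0034 * G.degree v) (hg : 1 ≤ G.gap v)
    (hEcard : G.degree v + 1 - 0.1765 * G.gap v ≤ E.card)
    (hnon : G.numNonAdj E < 0.15 * G.gap v * G.degree v) :
    G.gap v ≤ 0.46 * G.degree v := by
  have hgdef : G.gap v = G.degree v + 1 - G.cliqueNumAt v := rfl
  by_contra! hgt
  have hωE : G.cliqueNumAt v ≤ E.card := by
    have : (G.cliqueNumAt v : ℝ) ≤ E.card := by linarith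
    exact_mod_cast this
  -- With |E| − ω(v) ≥ 0.8235 g the quadratic bound against 0.15 g d gives 0.339 g < 0.156 d
  -- approximately, contradicting g > 0.46 d.
  have h1 := h.le_numNonAdj (s := 0.0034 * G.degree v) (by positivity) _ E rfl hvE hE hEsave hωE
  have hx1 : 0.8235 * G.gap v ≤ E.card - G.cliqueNumAt v := by linarith
  generalize (E.card : ℝ) - G.cliqueNumAt v = x at h1 hx1
  have hd0 : (0 : ℝ) ≤ G.degree v := Nat.cast_nonneg _
  generalize (G.degree v : ℝ) = d at *
  generalize G.gap v = g at *
  have h2 : (0.8235 * g) ^ 2 / 2 - 2 * (0.0034 * d) * (0.8235 * g) ≤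
      x ^ 2 / 2 - 2 * (0.0034 * d) * x := by
    have : 0 ≤ (x - 0.8235 * g) * ((x + 0.8235 * g) / 2 - 0.0068 * d) :=
      mul_nonneg (by linarith) (by linarith)
    nlinarith
  nlinarith

/-- Suppose there are fewer pairs. No vertex of `H` has enough nonneighbors for the first
obstruction, so a Hall obstruction `S` exists. Its size lies between 0.274 d and 0.5225 d, and each
of its vertices has at least 0.684 d − |S| nonneighbors. The concave product |S|(0.684 d − |S|) then
exceeds 0.15 · 0.46 d² throughout that range. -/
theorem IsListCritical.not_few_nonNbr (hL : G.HasLongLists L) (h : G.IsListCritical L) {v : V}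
    {H : Finset V} (hvH : v ∈ H) (hHadj : ∀ u ∈ H, u ≠ v → G.Adj v u)
    (hHsim : ∀ u ∈ H, u ≠ v → u ∈ G.similar L v) (hω1 : 1 ≤ G.cliqueNumAt v)
    (hv : (G.cliqueNumAt v : ℝ) + 1000 ≤ (L v).card) (hgd : G.gap v ≤ 0.46 * G.degree v)
    (hmass : G.outsideMass L v < 0.017 * G.gap v)
    (hHnon : ∀ u ∈ H, ((G.nonNbr H u).card : ℝ) ≤ 0.41 * G.degree v)
    (hn : G.degree v + 1 - 0.3595 * G.gap v ≤ H.card) :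
    0.15 * G.gap v * G.degree v ≤ G.numNonAdj H := by
  by_contra! hHT
  have hld : ((L v).card : ℝ) ≤ G.degree v := by exact_mod_cast h.card_le_degree v
  have hω1' : (1 : ℝ) ≤ G.cliqueNumAt v := by exact_mod_cast hω1
  have hgdef : G.gap v = G.degree v + 1 - G.cliqueNumAt v := rfl
  have hg1000 : 1000 ≤ G.gap v := by linarith
  have hlpos : 0 < (L v).card := by
    have : (0 : ℝ) < (L v).card := by linarith
    exact_mod_cast this
  have hsave : ∀ u ∈ H, G.save L u ≤ 0.0034 * G.degree v := by
    intro u hu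
    rcases eq_or_ne u v with rfl | huv
    · linarith [save_le_card hL u]
    · linarith [save_le_of_mem_similar hL (hHsim u hu huv)]
  -- The upper bound fits the available antimatching: 2 · 0.32 + 0.3595 < 1. The lower bound forces
  -- vertices of `S` to have many nonneighbors.
  obtain ⟨m, hm1, hm2⟩ : ∃ m : ℕ, 0.31 * G.gap v ≤ m ∧ (m : ℝ) ≤ 0.32 * G.gap v := by
    refine ⟨⌈0.31 * G.gap v⌉₊, Nat.le_ceil _, ?_⟩
    have := Nat.ceil_lt_add_one (show 0 ≤ 0.31 * G.gap v by linarith)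
    linarith
  have hm3 : 2 * m + G.cliqueNumAt v ≤ H.card + 1 := by
    have : 2 * (m : ℝ) + G.cliqueNumAt v ≤ H.card + 1 := by linarith
    exact_mod_cast this
  rcases h.exists_obstruction hvH hHadj hm3 with ⟨u, hu, hlt⟩ | ⟨S, hSH, hSne, hS⟩
  · have h1 := hHnon u hu
    have h2 := hsave u hu
    linarith
  have hSsim : ∀ u ∈ S, u ∈ G.similar L v := by
    intro u hu
    refine hHsim u (hSH hu) ?_
    rintro rfl
    have h1 := (hS u hu).1
    rw [nonNbr_self hHadj, Finset.card_empty, Nat.cast_zero] at h1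
    have h2 := save_le_gap hL u
    linarith
  have hslow : 0.274 * (G.degree v : ℝ) ≤ S.card := by
    obtain ⟨u, hu⟩ := hSne
    have h1 := (hS u hu).2
    have h2 := hHnon u (hSH hu)
    have h3 := hsave u (hSH hu)
    linarith
  -- Split `S` by how far the list leaves L(v). Vertices with more than gap(v) outside colors are
  -- limited by the outside mass. For the others, `save_le` and `cliqueNumAt_le_add` bound the save,
  -- so nonneighbors account for nearly all of `m`, and the pair count limits their number.
  have hab : (((S.filter fun u => G.gap v < (L u \ L v).card).card : ℝ)) ≤
      0.025 * G.degree v := by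
    have h1 := card_mul_le_outsideMass (G := G) (v := v) (t := G.gap v)
      (S := S.filter fun u => G.gap v < (L u \ L v).card) (by linarith) hlpos
      (fun u hu => (mem_similar.1 (hSsim u (Finset.mem_filter.1 hu).1)).1)
      (fun u hu => (Finset.mem_filter.1 hu).2.le)
    have h2 := mul_le_mul_of_nonneg_right hmass.le
      (show 0 ≤ ((L v).card : ℝ) + G.gap v by linarith)
    have h3 : (((S.filter fun u => G.gap v < (L u \ L v).card).card : ℝ)) * G.gap v ≤
        (0.017 * ((L v).card + G.gap v)) * G.gap v := by linarith
    have h4 := le_of_mul_le_mul_right h3 (by linarith)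
    linarith
  have hsum : ∀ (S' : Finset V) (r : ℝ), S' ⊆ S → (∀ u ∈ S', r ≤ (G.nonNbr H u).card) →
      (S'.card : ℝ) * r ≤ G.numNonAdj H := by
    intro S' r hS' hr
    rw [← nsmul_eq_mul, numNonAdj]
    push_cast
    exact (Finset.card_nsmul_le_sum _ _ _ hr).trans (Finset.sum_le_sum_of_subset_of_nonneg
      (hS'.trans hSH) fun _ _ _ => Nat.cast_nonneg _)
  have hnab : (((S.filter fun u => ¬ G.gap v < (L u \ L v).card).card : ℝ)) ≤
      0.4975 * G.degree v := by
    have h1 := hsum (S.filter fun u => ¬ G.gap v < (L u \ L v).card) (0.3018 * G.gap v)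
      (Finset.filter_subset _ _) (by
        intro u hu
        obtain ⟨hu, hle⟩ := Finset.mem_filter.1 hu
        rw [not_lt] at hle
        have h2 := card_le_card_add_card_sdiff (L := L) u v
        have h3 := (hS u hu).1
        have h4 := save_le hL u
        have h5 : (G.cliqueNumAt v : ℝ) + H.card ≤
            G.cliqueNumAt u + (G.nonNbr H u).card + G.degree v + 1 := by
          exact_mod_cast cliqueNumAt_le_add u
            (fun x hx => (eq_or_ne x v).imp id fun hxv => hHadj x hx hxv)
        linarith)
    have h2 : (((S.filter fun u => ¬ G.gap v < (L u \ L v).card).card : ℝ)) * 0.3018 *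
        G.gap v ≤ (0.15 * G.degree v) * G.gap v := by linarith
    have h3 := le_of_mul_le_mul_right h2 (by linarith)
    linarith
  have hsup : (S.card : ℝ) ≤ 0.5225 * G.degree v := by
    have h1 := Finset.card_filter_add_card_filter_not (s := S)
      (fun u => G.gap v < (L u \ L v).card)
    have h2 : (((S.filter fun u => G.gap v < (L u \ L v).card).card : ℝ)) +
        ((S.filter fun u => ¬ G.gap v < (L u \ L v).card).card : ℝ) = S.card := by
      rw [← h1]
      push_cast
      rfl
    linarith
  have hfinal := hsum S (0.684 * G.degree v - S.card) (Finset.Subset.refl _) (by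
    intro u hu
    have h1 := (hS u hu).2
    have h2 := hsave u (hSH hu)
    linarith)
  have hd0 : (0 : ℝ) < G.degree v := by linarith
  have hlast := (hfinal.trans_lt hHT).trans_le
    (mul_le_mul_of_nonneg_right (mul_le_mul_of_nonneg_left hgd (by norm_num)) hd0.le)
  have hmid := mul_nonneg (sub_nonneg.2 hslow) (sub_nonneg.2 hsup)
  generalize (S.card : ℝ) = s at *
  generalize (G.degree v : ℝ) = d at *
  nlinarith

/-- The three ways in which a vertex of a critical graph can save colors. -/
theorem IsListCritical.saving_cases (hL : G.HasLongLists L) (h : G.IsListCritical L) (v : V)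
    (hv : (G.cliqueNumAt v : ℝ) + 1000 ≤ (L v).card) :
    0.0065 * G.gap v ≤ (G.down L v).card ∨ 0.017 * G.gap v ≤ G.outsideMass L v ∨
      0.15 * G.gap v * G.degree v ≤ G.numNonAdj (G.similar L v) := by
  by_contra! hcon
  obtain ⟨hdown, hmass, hnon⟩ := hcon
  have hld : ((L v).card : ℝ) ≤ G.degree v := by exact_mod_cast h.card_le_degree v
  have hgdef : G.gap v = G.degree v + 1 - G.cliqueNumAt v := rfl
  have hω1 : 1 ≤ G.cliqueNumAt v :=
    card_le_cliqueNumAt (G := G) (s := {v}) (v := v) (by simp) (by simp)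
  have hω1' : (1 : ℝ) ≤ G.cliqueNumAt v := by exact_mod_cast hω1
  have hg1000 : 1000 ≤ G.gap v := by linarith
  have hlpos : 0 < (L v).card := by
    have : (0 : ℝ) < (L v).card := by linarith
    exact_mod_cast this
  have hsim := degree_le_card_similar (G := G) hlpos
  set E := insert v (G.similar L v) with hE
  have hvE : v ∈ E := Finset.mem_insert_self _ _
  have hvsim : v ∉ G.similar L v := fun h1 =>
    G.irrefl (mem_up.1 (mem_similar.1 h1).1).1
  have hEsim : ∀ u ∈ E, u ≠ v → u ∈ G.similar L v := fun u hu huv =>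
    (Finset.mem_insert.1 hu).resolve_left huv
  have hEadj : ∀ u ∈ E, u ≠ v → G.Adj v u := fun u hu huv =>
    (mem_up.1 (mem_similar.1 (hEsim u hu huv)).1).1
  have hEcard : (E.card : ℝ) = (G.similar L v).card + 1 := by
    rw [hE, Finset.card_insert_of_notMem hvsim]
    push_cast
    rfl
  have hEnon : G.numNonAdj E = G.numNonAdj (G.similar L v) := by
    rw [← numNonAdj_erase_self hvE hEadj, hE, Finset.erase_insert hvsim]
  rw [← hEnon] at hnon
  have hEsave : ∀ u ∈ E, G.save L u ≤ 0.0034 * G.degree v := by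
    intro u hu
    rcases eq_or_ne u v with rfl | huv
    · linarith [save_le_card hL u]
    · linarith [save_le_of_mem_similar hL (hEsim u hu huv)]
  have hd0 : (0 : ℝ) < G.degree v := by linarith
  -- The loss 0.1765 used here is 10 · 0.017 + 0.0065.
  have hgd := h.gap_le_degree hvE hEadj hEsave (by linarith) (by linarith) hnon
  obtain ⟨H, hHE, hvH, hHnon, hHcard⟩ := exists_subset_few_nonNbr (G := G)
    (r := 0.41 * G.degree v) (by positivity) _ E rfl hvE hEadj
  -- Each removed vertex destroys more than 2 · 0.41 d ordered pairs, so fewer than (0.15/0.82) g ≤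
  -- 0.183 g vertices go; 0.3595 = 0.1765 + 0.183.
  have hn : G.degree v + 1 - 0.3595 * G.gap v ≤ H.card := by
    have h1 : 0.82 * ((E.card : ℝ) - H.card) * G.degree v < 0.15 * G.gap v * G.degree v := by
      linarith
    have h2 := lt_of_mul_lt_mul_right h1 hd0.le
    linarith
  have hfew := h.not_few_nonNbr hL hvH (fun u hu => hEadj u (hHE hu)) (fun u hu => hEsim u (hHE hu))
    hω1 hv hgd hmass hHnon hn
  have : (G.numNonAdj H : ℝ) ≤ G.numNonAdj E := by exact_mod_cast numNonAdj_mono hHE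
  linarith

end SimpleGraph

/-! ### The random partial coloring and its greedy completion. -/

namespace SimpleGraph

variable {V C : Type*} [Fintype V] [DecidableEq V] [DecidableEq C]

/-- Greedy coloring in order of decreasing rank. -/
theorem exists_coloring_of_rank {G : SimpleGraph V} [DecidableRel G.Adj] [Nonempty C]
    (r : V → ℕ) (L : V → Finset C) (n : ℕ) :
    ∀ W : Finset V, W.card = n →
    (∀ v ∈ W, (W.filter fun u => G.Adj v u ∧ r v ≤ r u).card < (L v).card) →
    ∃ φ, G.IsPartialColoring L W φ := by
  induction n with
  | zero =>
    intro W hW _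
    rw [Finset.card_eq_zero] at hW
    subst hW
    exact ⟨fun _ => Classical.arbitrary C, by simp [IsPartialColoring]⟩
  | succ n ih =>
    intro W hW hr
    obtain ⟨v, hv, hmin⟩ := Finset.exists_min_image W r (Finset.card_pos.1 (by omega))
    obtain ⟨φ, hφL, hφ⟩ := ih (W.erase v) (by rw [Finset.card_erase_of_mem hv, hW]; rfl) (by
      intro u hu
      refine (Finset.card_le_card ?_).trans_lt (hr u (Finset.mem_of_mem_erase hu))
      exact Finset.filter_subset_filter _ (W.erase_subset v))
    obtain ⟨c, hc⟩ : ∃ c, c ∈ L v \ (W.filter fun u => G.Adj v u ∧ r v ≤ r u).image φ := by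
      refine Finset.card_pos.1 ?_
      have h1 := Finset.le_card_sdiff ((W.filter fun u => G.Adj v u ∧ r v ≤ r u).image φ) (L v)
      have h2 : ((W.filter fun u => G.Adj v u ∧ r v ≤ r u).image φ).card ≤
        (W.filter fun u => G.Adj v u ∧ r v ≤ r u).card := Finset.card_image_le
      have h3 := hr v hv
      omega
    obtain ⟨hcL, hcφ⟩ := Finset.mem_sdiff.1 hc
    have hne : ∀ u ∈ W, G.Adj v u → c ≠ φ u := by
      rintro u hu huv rfl
      exact hcφ (Finset.mem_image_of_mem φ (Finset.mem_filter.2 ⟨hu, huv, hmin u hu⟩))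
    refine ⟨Function.update φ v c, fun u hu => ?_, fun u hu w hw huw => ?_⟩
    · by_cases huv : u = v
      · subst huv
        simpa using hcL
      · simpa [huv] using hφL u (Finset.mem_erase.2 ⟨huv, hu⟩)
    · by_cases huv : u = v
      · subst huv
        simpa [huw.ne'] using hne w hw huw
      · by_cases hwv : w = v
        · subst hwv
          simpa [huv] using (hne u hu huw.symm).symm
        · simpa [huv, hwv] using hφ u (Finset.mem_erase.2 ⟨huv, hu⟩) w
            (Finset.mem_erase.2 ⟨hwv, hw⟩) huw

variable (G : SimpleGraph V) [DecidableRel G.Adj] (L : V → Finset C)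

/-- The color kept by `u`: it is discarded if some neighbor in `up u` has been assigned it too. -/
def kept (a : V → Option C) (u : V) : Option C :=
  if ∀ x ∈ G.up L u, a x ≠ a u then a u else none

/-- The colors of `L v` kept by some neighbor of `v`. -/
def keptColors (a : V → Option C) (v : V) : Finset C :=
  (L v).filter fun c => ∃ u ∈ G.neighborFinset v, G.kept L a u = some c

/-- After the random step, `v` can still be colored greedily. -/
def IsGood (a : V → Option C) (v : V) : Prop :=
  ((G.up L v).filter fun u => G.kept L a u = none).card + (G.keptColors L a v).card < (L v).card

variable {G L}

theorem kept_eq_some {a : V → Option C} {u : V} {c : C} :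
    G.kept L a u = some c ↔ a u = some c ∧ ∀ x ∈ G.up L u, a x ≠ some c := by
  unfold kept
  split_ifs with h
  · constructor
    · exact fun hu => ⟨hu, fun x hx => hu ▸ h x hx⟩
    · exact fun hu => hu.1
  · simp only [false_iff, not_and]
    intro hu hall
    exact h fun x hx => hu ▸ hall x hx

/-- In a conflict the end with the shorter list gives way; with equal lengths both do, since `up`
uses a weak inequality. -/
theorem kept_ne_of_adj {a : V → Option C} {u v : V} {c : C} (huv : G.Adj u v)
    (hu : G.kept L a u = some c) : G.kept L a v ≠ some c := by
  intro hv
  rw [kept_eq_some] at hu hv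
  rcases le_total (L u).card (L v).card with h | h
  · exact hu.2 v (mem_up.2 ⟨huv, h⟩) hv.1
  · exact hv.2 u (mem_up.2 ⟨huv.symm, h⟩) hu.1

/-- Kept colors form a proper partial coloring. The other vertices are colored with longer lists
first, so only uncolored neighbors in `up v` compete with v for the colors left to it. -/
theorem listColorable_of_isGood {a : V → Option C} (ha : ∀ v c, a v = some c → c ∈ L v)
    (hgood : ∀ v, G.IsGood L a v) : G.ListColorable L := by
  rcases isEmpty_or_nonempty C with hC | hC
  · refine IsPartialColoring.listColorable (φ := fun v => ?_) ⟨fun v => ?_, fun v => ?_⟩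
    all_goals
      have h := hgood v
      simp [IsGood, Finset.eq_empty_of_isEmpty] at h
  set W := Finset.univ.filter fun v => G.kept L a v = none with hW
  obtain ⟨φ, hφL, hφ⟩ := exists_coloring_of_rank (G := G) (fun v => (L v).card)
    (fun v => L v \ G.keptColors L a v) _ W rfl (by
      intro v _
      have h1 := hgood v
      have h2 := Finset.le_card_sdiff (G.keptColors L a v) (L v)
      have h3 : (W.filter fun u => G.Adj v u ∧ (L v).card ≤ (L u).card) =
          (G.up L v).filter fun u => G.kept L a u = none := by
        ext u
        simp only [hW, Finset.mem_filter, Finset.mem_univ, true_and, mem_up]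
        tauto
      rw [h3]
      rw [IsGood] at h1
      omega)
  have hout : ∀ u v c, G.kept L a v = none → G.Adj u v → G.kept L a u = some c → φ v ≠ c := by
    rintro u v c hv huv hu rfl
    have h1 := hφL v (by simp [hW, hv])
    rw [Finset.mem_sdiff] at h1
    exact h1.2 (Finset.mem_filter.2 ⟨h1.1, u, by simpa using huv.symm, hu⟩)
  refine IsPartialColoring.listColorable (φ := fun v => (G.kept L a v).getD (φ v))
    ⟨fun v _ => ?_, fun u _ v _ huv => ?_⟩
  · cases h : G.kept L a v with
    | none => simpa [h] using (Finset.mem_sdiff.1 (hφL v (by simp [hW, h]))).1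
    | some c => simpa [h] using ha v c (kept_eq_some.1 h).1
  · cases hu : G.kept L a u with
    | none =>
      cases hv : G.kept L a v with
      | none => simpa [hu, hv] using hφ u (by simp [hW, hu]) v (by simp [hW, hv]) huv
      | some c => simpa [hu, hv] using hout v u c hu huv.symm hv
    | some c =>
      cases hv : G.kept L a v with
      | none => simpa [hu, hv] using (hout u v c hv huv hu).symm
      | some c' =>
        intro h
        simp only [hu, hv, Option.getD_some] at h
        exact kept_ne_of_adj huv hu (h ▸ hv)

/-- The ball of radius two around `v`. -/
def ballTwo (G : SimpleGraph V) [DecidableRel G.Adj] (v : V) : Finset V :=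
  (insert v (G.neighborFinset v)).biUnion fun u => insert u (G.neighborFinset u)

theorem mem_ballTwo_comm {u v : V} : u ∈ G.ballTwo v ↔ v ∈ G.ballTwo u := by
  simp only [ballTwo, Finset.mem_biUnion, Finset.mem_insert, mem_neighborFinset]
  have key : ∀ {u v : V}, (∃ x, (x = v ∨ G.Adj v x) ∧ (u = x ∨ G.Adj x u)) →
      ∃ x, (x = u ∨ G.Adj u x) ∧ (v = x ∨ G.Adj x v) := by
    rintro u v ⟨x, hx, hy⟩
    exact ⟨x, hy.imp Eq.symm Adj.symm, hx.imp Eq.symm Adj.symm⟩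
  exact ⟨key, key⟩

theorem card_ballTwo_le {Δ : ℕ} (hΔ : ∀ u, G.degree u ≤ Δ) (v : V) :
    (G.ballTwo v).card ≤ (Δ + 1) ^ 2 := by
  have h : ∀ u, (insert u (G.neighborFinset u)).card ≤ Δ + 1 := fun u =>
    (Finset.card_insert_le _ _).trans (by
      rw [card_neighborFinset_eq_degree]
      exact Nat.succ_le_succ (hΔ u))
  rw [ballTwo, sq]
  exact (Finset.card_biUnion_le_card_mul _ _ _ fun u _ => h u).trans
    (Nat.mul_le_mul_right _ (h v))

theorem ncard_not_disjoint_ballTwo_le {Δ : ℕ} (hΔ : ∀ u, G.degree u ≤ Δ) (v : V) :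
    {u : V | ¬ Disjoint (G.ballTwo v) (G.ballTwo u)}.ncard ≤ (Δ + 1) ^ 4 := by
  have h1 : {u : V | ¬ Disjoint (G.ballTwo v) (G.ballTwo u)} ⊆
      ((G.ballTwo v).biUnion fun x => G.ballTwo x : Finset V) := by
    intro u hu
    obtain ⟨x, hx, hx'⟩ := Finset.not_disjoint_iff.1 hu
    exact Finset.mem_coe.2 (Finset.mem_biUnion.2 ⟨x, hx, mem_ballTwo_comm.1 hx'⟩)
  refine (Set.ncard_le_ncard h1 (Finset.finite_toSet _)).trans ?_
  rw [Set.ncard_coe_finset]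
  refine (Finset.card_biUnion_le_card_mul _ _ _ fun x _ => card_ballTwo_le hΔ x).trans ?_
  calc _ ≤ (Δ + 1) ^ 2 * (Δ + 1) ^ 2 := Nat.mul_le_mul_right _ (card_ballTwo_le hΔ v)
    _ = _ := by ring

theorem isGood_congr {a b : V → Option C} {v : V} (h : ∀ x ∈ G.ballTwo v, a x = b x) :
    G.IsGood L a v ↔ G.IsGood L b v := by
  have hk : ∀ u ∈ G.neighborFinset v, G.kept L a u = G.kept L b u := by
    intro u hu
    have hmem : ∀ x, x = u ∨ G.Adj u x → x ∈ G.ballTwo v := by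
      intro x hx
      rw [ballTwo, Finset.mem_biUnion]
      exact ⟨u, Finset.mem_insert_of_mem hu, by simpa using hx⟩
    have hu' := h u (hmem u (Or.inl rfl))
    have hiff : (∀ x ∈ G.up L u, a x ≠ a u) ↔ ∀ x ∈ G.up L u, b x ≠ b u := by
      refine forall₂_congr fun x hx => ?_
      rw [hu', h x (hmem x (Or.inr (mem_up.1 hx).1))]
    unfold kept
    rw [hu'] at hiff ⊢
    simp only [hiff]
  have h1 : ((G.up L v).filter fun u => G.kept L a u = none) =
      (G.up L v).filter fun u => G.kept L b u = none :=
    Finset.filter_congr fun u hu => by rw [hk u (up_subset v hu)]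
  have h2 : G.keptColors L a v = G.keptColors L b v :=
    Finset.filter_congr fun c _ => exists_congr fun u =>
      and_congr_right fun hu => by rw [hk u hu]
  rw [IsGood, IsGood, h1, h2]

/-- The neighbors of `v` that keep their color. -/
def keptNbrs (G : SimpleGraph V) [DecidableRel G.Adj] (L : V → Finset C) (a : V → Option C)
    (v : V) : Finset V := (G.neighborFinset v).filter fun u => G.kept L a u ≠ none

/-- Every neighbor costs v at most one color: an uncolored one in `up v` by the greedy step, a kept
one by its color. Uncolored neighbors in `down v` cost nothing, and neither do colors that are
repeated or lie outside L(v). -/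
theorem isGood_of_le {a : V → Option C} {v : V} {s : ℕ}
    (hs : ((G.down L v).filter fun u => G.kept L a u ≠ none).card + s ≤ (G.down L v).card ∨
      (G.keptColors L a v).card + s ≤ (G.keptNbrs L a v).card)
    (hsave : G.save L v ≤ s) : G.IsGood L a v := by
  have h1 : ((G.up L v).filter fun u => G.kept L a u = none).card +
      ((G.up L v).filter fun u => G.kept L a u ≠ none).card = (G.up L v).card :=
    Finset.card_filter_add_card_filter_not _
  have h2 : ((G.up L v).filter fun u => G.kept L a u ≠ none).card +
      ((G.down L v).filter fun u => G.kept L a u ≠ none).card = (G.keptNbrs L a v).card := by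
    rw [← Finset.card_union_of_disjoint]
    · congr 1
      ext u
      simp only [Finset.mem_union, Finset.mem_filter, mem_up, mem_down, keptNbrs,
        mem_neighborFinset]
      have := le_or_gt (L v).card (L u).card
      tauto
    · rw [Finset.disjoint_left]
      intro u hu hu'
      have h3 := (mem_up.1 (Finset.mem_filter.1 hu).1).2
      have h4 := (mem_down.1 (Finset.mem_filter.1 hu').1).2
      omega
  have h3 := card_up_add_card_down (G := G) (L := L) v
  have h4 : (G.keptColors L a v).card ≤ (G.keptNbrs L a v).card := by
    rw [← Finset.card_image_of_injective _ (Option.some_injective C)]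
    refine (Finset.card_le_card ?_).trans (Finset.card_image_le (f := G.kept L a))
    intro o ho
    obtain ⟨c, hc, rfl⟩ := Finset.mem_image.1 ho
    obtain ⟨u, hu, huc⟩ := (Finset.mem_filter.1 hc).2
    exact Finset.mem_image.2 ⟨u, Finset.mem_filter.2 ⟨hu, by simp [huc]⟩, huc⟩
  have h5 : G.degree v + 1 ≤ s + (L v).card := by
    rw [save] at hsave
    have : (G.degree v : ℝ) + 1 ≤ s + (L v).card := by linarith
    exact_mod_cast this
  have h6 := Finset.card_filter_le (G.down L v) fun u => G.kept L a u ≠ none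
  rw [IsGood]
  omega

/-- Group the neighbors by kept color. A color of `P` outside L(v) has a nonempty class that blocks
nothing, and one inside L(v) has a class of at least two that blocks one color. -/
theorem card_keptColors_add_le {a : V → Option C} {v : V} {P : Finset C}
    (hP : ∀ c ∈ P, (c ∉ L v ∧ ∃ u ∈ G.neighborFinset v, G.kept L a u = some c) ∨
      (c ∈ L v ∧ ∃ u ∈ G.neighborFinset v, ∃ w ∈ G.neighborFinset v, u ≠ w ∧
        G.kept L a u = some c ∧ G.kept L a w = some c)) :
    (G.keptColors L a v).card + P.card ≤ (G.keptNbrs L a v).card := by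
  set Q := G.keptColors L a v ∪ P with hQ
  let fib : C → Finset V := fun c => (G.neighborFinset v).filter fun u => G.kept L a u = some c
  have hmem : ∀ {c u}, u ∈ fib c ↔ u ∈ G.neighborFinset v ∧ G.kept L a u = some c := by
    intro c u
    simp [fib]
  have hsum : ∑ c ∈ Q, (fib c).card ≤ (G.keptNbrs L a v).card := by
    rw [← Finset.card_biUnion]
    · refine Finset.card_le_card fun u hu => ?_
      obtain ⟨c, -, hc⟩ := Finset.mem_biUnion.1 hu
      rw [hmem] at hc
      exact Finset.mem_filter.2 ⟨hc.1, by simp [hc.2]⟩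
    · intro c _ c' _ hcc'
      change Disjoint (fib c) (fib c')
      rw [Finset.disjoint_left]
      intro u hu hu'
      rw [hmem] at hu hu'
      exact hcc' (Option.some_injective C (hu.2.symm.trans hu'.2))
  have hle : ∀ c ∈ Q, ((if c ∈ G.keptColors L a v then 1 else 0) + if c ∈ P then 1 else 0) ≤
      (fib c).card := by
    intro c hc
    have h1 : c ∈ G.keptColors L a v → 1 ≤ (fib c).card := by
      intro h
      obtain ⟨u, hu, huc⟩ := (Finset.mem_filter.1 h).2
      exact Finset.card_pos.2 ⟨u, hmem.2 ⟨hu, huc⟩⟩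
    by_cases hcP : c ∈ P
    · rcases hP c hcP with ⟨hcL, u, hu, huc⟩ | ⟨hcL, u, hu, w, hw, huw, huc, hwc⟩
      · have h2 : c ∉ G.keptColors L a v := fun h => hcL (Finset.mem_filter.1 h).1
        have h3 : 1 ≤ (fib c).card := Finset.card_pos.2 ⟨u, hmem.2 ⟨hu, huc⟩⟩
        simpa [h2, hcP] using h3
      · have h3 : 1 < (fib c).card :=
          Finset.one_lt_card.2 ⟨u, hmem.2 ⟨hu, huc⟩, w, hmem.2 ⟨hw, hwc⟩, huw⟩
        split_ifs <;> omega
    · split_ifs with h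
      · exact h1 h
      · exact Nat.zero_le _
  have h := (Finset.sum_le_sum hle).trans hsum
  rw [Finset.sum_add_distrib, Finset.sum_ite_mem, Finset.sum_ite_mem] at h
  have e1 : Q ∩ G.keptColors L a v = G.keptColors L a v :=
    Finset.inter_eq_right.2 Finset.subset_union_left
  have e2 : Q ∩ P = P := Finset.inter_eq_right.2 Finset.subset_union_right
  simpa [e1, e2] using h

end SimpleGraph

/-! ### Assignment probabilities and differences of monochromatic counts. -/

namespace FiniteProduct

variable {ι β : Type*} [Fintype ι] [DecidableEq ι] [Fintype β]

theorem IsWeight.le_one {w : ι → β → ℝ} (hw : IsWeight w) (i : ι) (b : β) : w i b ≤ 1 :=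
  hw.sum_eq_one i ▸ Finset.single_le_sum (fun b _ => hw.nonneg i b) (Finset.mem_univ b)

theorem prob_assign [DecidableEq β] {w : ι → β → ℝ} (hw : IsWeight w) {A T : Finset ι}
    (hAT : Disjoint A T) (b : β) :
    prob w {a | (∀ i ∈ A, a i = b) ∧ ∀ i ∈ T, a i ≠ b} =
      (∏ i ∈ A, w i b) * ∏ i ∈ T, (1 - w i b) := by
  have h1 : {a : ι → β | (∀ i ∈ A, a i = b) ∧ ∀ i ∈ T, a i ≠ b} =
      {a | ∀ i, a i ∈ if i ∈ A then {b} else if i ∈ T then Finset.univ.erase b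
        else Finset.univ} := by
    ext a
    simp only [Set.mem_ofPred_eq]
    constructor
    · rintro ⟨hA, hT⟩ i
      split_ifs with h h'
      · simpa using hA i h
      · simpa using hT i h'
      · simp
    · intro h
      refine ⟨fun i hi => by simpa [hi] using h i, fun i hi => ?_⟩
      have hiA : i ∉ A := fun h' => Finset.disjoint_left.1 hAT h' hi
      simpa [hi, hiA] using h i
  have h2 : ∀ i, ∑ x ∈ (if i ∈ A then {b} else if i ∈ T then Finset.univ.erase b
      else Finset.univ), w i x = (if i ∈ A then w i b else 1) * if i ∈ T then 1 - w i b else 1 := by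
    intro i
    by_cases hA : i ∈ A
    · have hT : i ∉ T := fun h => Finset.disjoint_left.1 hAT hA h
      simp [hA, hT]
    · by_cases hT : i ∈ T
      · have := Finset.add_sum_erase Finset.univ (w i) (Finset.mem_univ b)
        rw [hw.sum_eq_one] at this
        simp only [hA, hT, if_true, if_false, one_mul]
        linarith
      · simp [hA, hT, hw.sum_eq_one]
  rw [h1, prob_forall_mem]
  simp only [h2, Finset.prod_mul_distrib, Finset.prod_ite_mem, Finset.univ_inter]

theorem prod_le_prod_of_subset_of_le_one {f : ι → ℝ} {S T : Finset ι} (h : S ⊆ T)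
    (h0 : ∀ i, 0 ≤ f i) (h1 : ∀ i, f i ≤ 1) : ∏ i ∈ T, f i ≤ ∏ i ∈ S, f i := by
  rw [← Finset.prod_sdiff h]
  exact mul_le_of_le_one_left (Finset.prod_nonneg fun i _ => h0 i)
    (Finset.prod_le_one (fun i _ => h0 i) fun i _ => h1 i)

theorem prod_mul_prod_le_prod_union {f : ι → ℝ} (S T : Finset ι)
    (h0 : ∀ i, 0 ≤ f i) (h1 : ∀ i, f i ≤ 1) :
    (∏ i ∈ S, f i) * ∏ i ∈ T, f i ≤ ∏ i ∈ S ∪ T, f i := by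
  rw [← Finset.prod_union_inter]
  exact mul_le_of_le_one_right (Finset.prod_nonneg fun i _ => h0 i)
    (Finset.prod_le_one (fun i _ => h0 i) fun i _ => h1 i)

theorem monoCount_eq_card {κ C : Type*} (S : Finset C) (𝓕 : Set (Finset κ)) (a : κ → Option C)
    [DecidablePred fun c => ∃ T ∈ 𝓕, ∀ i ∈ T, a i = some c] :
    monoCount S 𝓕 a = (S.filter fun c => ∃ T ∈ 𝓕, ∀ i ∈ T, a i = some c).card := by
  rw [monoCount, ← Set.ncard_coe_finset, Finset.coe_filter]

theorem monoCount_eq_sum {κ C : Type*} (S : Finset C) (𝓕 : Set (Finset κ)) (a : κ → Option C)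
    [DecidablePred fun c => ∃ T ∈ 𝓕, ∀ i ∈ T, a i = some c] :
    (monoCount S 𝓕 a : ℝ) =
      ∑ c ∈ S, if ∃ T ∈ 𝓕, ∀ i ∈ T, a i = some c then (1 : ℝ) else 0 := by
  rw [monoCount_eq_card, Finset.sum_boole]

theorem monoCount_mono {κ C : Type*} {S : Finset C} {𝓕 𝓖 : Set (Finset κ)}
    (h : ∀ T ∈ 𝓖, ∃ T' ∈ 𝓕, T' ⊆ T) (a : κ → Option C) :
    monoCount S 𝓖 a ≤ monoCount S 𝓕 a := by
  refine Set.ncard_le_ncard ?_ (S.finite_toSet.subset fun c hc => hc.1)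
  rintro c ⟨hcS, T, hT, hTa⟩
  obtain ⟨T', hT', hsub⟩ := h T hT
  exact ⟨hcS, T', hT', fun i hi => hTa i (hsub hi)⟩

/-- A color counted by `𝓕` but not by `𝓖` is one whose saving survives conflicts. That number need
not be certifiable, but it dominates a difference of two counts that are. -/
theorem exists_monoCount_sub_le {κ C : Type*} (S : Finset C) (𝓕 𝓖 : Set (Finset κ))
    (a : κ → Option C) : ∃ P ⊆ S, (∀ c ∈ P, (∃ T ∈ 𝓕, ∀ i ∈ T, a i = some c) ∧
      ¬ ∃ T ∈ 𝓖, ∀ i ∈ T, a i = some c) ∧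
      (monoCount S 𝓕 a : ℝ) - monoCount S 𝓖 a ≤ P.card := by
  classical
  refine ⟨S.filter fun c => (∃ T ∈ 𝓕, ∀ i ∈ T, a i = some c) ∧
      ¬ ∃ T ∈ 𝓖, ∀ i ∈ T, a i = some c, Finset.filter_subset _ _,
      fun c hc => (Finset.mem_filter.1 hc).2, ?_⟩
  rw [monoCount_eq_sum, monoCount_eq_sum, ← Finset.sum_boole, ← Finset.sum_sub_distrib]
  refine Finset.sum_le_sum fun c _ => ?_
  by_cases h1 : ∃ T ∈ 𝓕, ∀ i ∈ T, a i = some c <;>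
    by_cases h2 : ∃ T ∈ 𝓖, ∀ i ∈ T, a i = some c <;> simp [h1, h2]

theorem expect_ite_eq_prob {w : ι → β → ℝ} (p : (ι → β) → Prop) [DecidablePred p] :
    expect w (fun a => if p a then (1 : ℝ) else 0) = prob w {a | p a} := by
  rw [prob]
  congr! with a

theorem le_monoCount_sub {C : Type*} {S : Finset C} {𝓕 𝓖 : Set (Finset ι)}
    {F : C → (ι → Option C) → ℝ} {a : ι → Option C}
    (h : ∀ c ∈ S, F c a ≤ 0 ∨ (F c a ≤ 1 ∧ (∃ T ∈ 𝓕, ∀ i ∈ T, a i = some c) ∧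
      ¬ ∃ T ∈ 𝓖, ∀ i ∈ T, a i = some c))
    (h𝓖 : ∀ T ∈ 𝓖, ∃ T' ∈ 𝓕, T' ⊆ T) :
    ∑ c ∈ S, F c a ≤ (monoCount S 𝓕 a : ℝ) - monoCount S 𝓖 a := by
  classical
  rw [monoCount_eq_sum, monoCount_eq_sum, ← Finset.sum_sub_distrib]
  refine Finset.sum_le_sum fun c hc => ?_
  rcases h c hc with h | ⟨h, h1, h2⟩
  · refine h.trans ?_
    by_cases hG : ∃ T ∈ 𝓖, ∀ i ∈ T, a i = some c
    · have hF : ∃ T ∈ 𝓕, ∀ i ∈ T, a i = some c := by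
        obtain ⟨T, hT, hTa⟩ := hG
        obtain ⟨T', hT', hsub⟩ := h𝓖 T hT
        exact ⟨T', hT', fun i hi => hTa i (hsub hi)⟩
      simp [hF, hG]
    · rw [if_neg hG, sub_zero]
      split_ifs <;> norm_num
  · rw [if_pos h1, if_neg h2]
    linarith

end FiniteProduct

/-! ### The random assignment and savings from blank neighbors with shorter lists. -/

namespace SimpleGraph

open FiniteProduct

variable {V C : Type*} [Fintype V] [DecidableEq V] [DecidableEq C]

/-- A vertex receives no color with probability `1 / 2`, and else a uniform color of its list. -/
noncomputable def listWeight (L : V → Finset C) (v : V) : Option C → ℝ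
  | none => 1 / 2
  | some c => if c ∈ L v then 1 / (2 * (L v).card) else 0

theorem isWeight_listWeight [Fintype C] {L : V → Finset C} (hL : ∀ v, 0 < (L v).card) :
    IsWeight (listWeight L) := by
  refine ⟨fun v o => ?_, fun v => ?_⟩
  · cases o with
    | none => norm_num [listWeight]
    | some c =>
      simp only [listWeight]
      split_ifs <;> positivity
  · have : (0 : ℝ) < (L v).card := by exact_mod_cast hL v
    rw [Fintype.sum_option]
    simp only [listWeight, Finset.sum_ite_mem, Finset.univ_inter, Finset.sum_const, nsmul_eq_mul]
    field_simp
    norm_num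

theorem mem_of_weight_ne_zero {L : V → Finset C} {a : V → Option C}
    (ha : weight (listWeight L) a ≠ 0) {v : V} {c : C} (hc : a v = some c) : c ∈ L v := by
  by_contra h
  refine ha (Finset.prod_eq_zero (Finset.mem_univ v) ?_)
  rw [hc]
  simp [listWeight, h]

/-- Use 1 − 1/(2k) ≥ exp(−1/(2k − 1)). Here n/(2k − 1) is just above 1/2, at most 0.504, and
exp(−0.504) ≥ 0.6016. This bounds the chance of avoiding one given color on up to n vertices. -/
theorem le_one_sub_pow {k n : ℕ} (hk : 1000 ≤ k) (hn : (329 : ℝ) / 330 * n ≤ k) :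
    0.6016 ≤ (1 - 1 / (2 * (k : ℝ))) ^ n := by
  have hk' : (1000 : ℝ) ≤ k := by exact_mod_cast hk
  have hpos : (0 : ℝ) < 2 * k - 1 := by linarith
  have h1 : Real.exp (-(1 / (2 * k - 1))) ≤ 1 - 1 / (2 * (k : ℝ)) := by
    have h2 : 1 - 1 / (2 * (k : ℝ)) = (1 / (2 * (k : ℝ) - 1) + 1)⁻¹ := by
      field_simp
      ring
    rw [h2, Real.exp_neg]
    exact inv_anti₀ (by positivity) (Real.add_one_le_exp _)
  have h2 : Real.exp (-0.504) ≤ Real.exp (n * -(1 / (2 * k - 1))) := by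
    rw [Real.exp_le_exp, mul_neg, neg_le_neg_iff, mul_one_div, div_le_iff₀ hpos]
    linarith
  have h3 : (0.6016 : ℝ) ≤ Real.exp (-0.504) := by
    have := Real.exp_bound' (x := 0.504) (by norm_num) (by norm_num) (n := 4) (by norm_num)
    rw [Real.exp_neg, le_inv_comm₀ (by norm_num) (Real.exp_pos _)]
    refine this.trans ?_
    norm_num [Finset.sum_range_succ, Nat.factorial]
  calc (0.6016 : ℝ) ≤ _ := h3.trans h2
    _ = Real.exp (-(1 / (2 * k - 1))) ^ n := Real.exp_nat_mul _ _
    _ ≤ _ := pow_le_pow_left₀ (Real.exp_pos _).le h1 n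

variable {G : SimpleGraph V} [DecidableRel G.Adj] {L : V → Finset C}

theorem le_prod_up (hL : G.HasLongLists L) {v : V} (hv : 1000 ≤ (L v).card) {S : Finset V}
    (hS : S ⊆ G.up L v) (c : C) : 0.6016 ≤ ∏ x ∈ S, (1 - listWeight L x (some c)) := by
  have hv' : (1000 : ℝ) ≤ (L v).card := by exact_mod_cast hv
  refine (le_one_sub_pow (n := S.card) hv ?_).trans ?_
  · have h1 := hL v
    have h2 : (S.card : ℝ) ≤ G.degree v := by
      rw [← card_neighborFinset_eq_degree]
      exact_mod_cast Finset.card_le_card (hS.trans (up_subset v))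
    have h3 : (0 : ℝ) ≤ G.cliqueNumAt v := Nat.cast_nonneg _
    linarith
  · rw [← Finset.prod_const]
    refine Finset.prod_le_prod (fun x _ => ?_) fun x hx => ?_
    · rw [sub_nonneg, div_le_one (by linarith)]
      linarith
    · have h1 : ((L v).card : ℝ) ≤ (L x).card := Nat.cast_le.2 (mem_up.1 (hS hx)).2
      simp only [listWeight]
      split_ifs
      · have := one_div_le_one_div_of_le (show (0 : ℝ) < 2 * (L v).card by linarith)
          (show 2 * ((L v).card : ℝ) ≤ 2 * (L x).card by linarith)
        linarith
      · rw [sub_zero, sub_le_self_iff]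
        positivity

variable [Fintype C]

/-- Enough expected savings make it very unlikely that `v` is not good. -/
theorem prob_not_isGood_le_of_expect (hL : ∀ v, 0 < (L v).card) {v : V} {Δ : ℕ} {R M : ℝ}
    {X Y : (V → Option C) → ℕ} (hX : Certifiable X) (hY : Certifiable Y)
    (hXΔ : ∀ a, X a ≤ Δ) (hYX : ∀ a, Y a ≤ X a)
    (hXM : expect (listWeight L) (fun a => (X a : ℝ)) ≤ M)
    (hE : G.save L v + 0.002 * M ≤ expect (listWeight L) (fun a => (X a : ℝ) - Y a))
    (hgood : ∀ a, G.save L v ≤ (X a : ℝ) - Y a → G.IsGood L a v)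
    (hR : 1000000 ≤ R) (hRM : 0.0065 * R ≤ M) :
    prob (listWeight L) {a | ¬ G.IsGood L a v} ≤ 2 * (Δ + 1) * Real.exp (-(R / 10 ^ 12)) := by
  have hw := isWeight_listWeight hL
  -- With δ = 0.0005 the deviation 4δM is the margin 0.002 M in `hE`, and δ²M/162 ≥ R/10^12 because
  -- M ≥ 0.0065 R.
  have h1 := prob_sub_le_expect_sub hw hX hY hXΔ (fun a => (hYX a).trans (hXΔ a)) (M := M)
    (δ := 0.0005) hXM ((expect_mono hw fun a => Nat.cast_le.2 (hYX a)).trans hXM)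
    (by linarith) (by norm_num) (by norm_num)
  refine (prob_mono hw fun a ha => ?_).trans (h1.trans ?_)
  · rw [← expect_sub]
    by_contra hcon
    have h2 := not_le.1 (show ¬ (X a : ℝ) - Y a ≤ _ from hcon)
    exact ha (hgood a (by linarith))
  · refine mul_le_mul_of_nonneg_left (Real.exp_le_exp.2 ?_) (by positivity)
    rw [neg_le_neg_iff]
    linarith

theorem prob_not_isGood_le_of_down (hL : ∀ v, 0 < (L v).card) {v : V} {Δ : ℕ} {R : ℝ}
    (hΔ : G.degree v ≤ Δ) (hR : 1000000 ≤ R) (hRg : R ≤ G.gap v)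
    (hsave : 330 * G.save L v ≤ G.gap v)
    (hdown : 0.0065 * G.gap v ≤ (G.down L v).card) :
    prob (listWeight L) {a | ¬ G.IsGood L a v} ≤ 2 * (Δ + 1) * Real.exp (-(R / 10 ^ 12)) := by
  have hw := isWeight_listWeight hL
  let X : (V → Option C) → ℕ := fun a => ((G.down L v).filter fun u => a u = none).card
  have hXd : ∀ a, X a ≤ (G.down L v).card := fun a => Finset.card_filter_le _ _
  have hXsum : ∀ a, (X a : ℝ) = ∑ u ∈ G.down L v, if a u = none then (1 : ℝ) else 0 :=
    fun a => by rw [Finset.sum_boole]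
  have hprob : ∀ u, expect (listWeight L) (fun a => if a u = none then (1 : ℝ) else 0) =
      1 / 2 := by
    intro u
    rw [expect_ite_eq_prob]
    simpa [listWeight] using prob_assign hw (A := {u}) (T := ∅) (by simp) (none : Option C)
  have hEX : expect (listWeight L) (fun a => (X a : ℝ)) = (G.down L v).card * (1 / 2) := by
    simp only [hXsum]
    rw [expect_sum]
    simp only [hprob, Finset.sum_const, nsmul_eq_mul]
  -- Half of 0.0065, less the margin, still exceeds 1/330. Blank neighbors cannot keep a color, so
  -- no conflicts need subtracting.
  refine prob_not_isGood_le_of_expect hL (X := X) (Y := fun _ => 0) (M := (G.down L v).card)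
    ?_ ?_ ?_ (fun a => Nat.zero_le _) ?_ ?_ ?_ hR (by linarith)
  · intro a
    refine ⟨(G.down L v).filter fun u => a u = none, by change _ ≤ 3 * Finset.card _; omega,
      fun b => ?_⟩
    have hsub : ((G.down L v).filter fun u => a u = none) ⊆
        ((G.down L v).filter fun u => b u = none) ∪
          ((G.down L v).filter fun u => a u = none).filter fun u => a u ≠ b u := by
      intro u hu
      simp only [Finset.mem_union, Finset.mem_filter] at hu ⊢
      by_cases h : b u = none
      · exact Or.inl ⟨hu.1, h⟩
      · exact Or.inr ⟨hu, fun h' => h (h' ▸ hu.2)⟩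
    have h1 := (Finset.card_le_card hsub).trans (Finset.card_union_le _ _)
    have h2 : {i | i ∈ ((G.down L v).filter fun u => a u = none) ∧ a i ≠ b i} =
        (((G.down L v).filter fun u => a u = none).filter fun u => a u ≠ b u : Finset V) := by
      ext i
      simp
    rw [h2, Set.ncard_coe_finset]
    exact h1
  · exact fun a => ⟨∅, by simp, by simp⟩
  · intro a
    have := card_up_add_card_down (G := G) (L := L) v
    have := hXd a
    omega
  · rw [hEX]
    have : (0 : ℝ) ≤ (G.down L v).card := Nat.cast_nonneg _
    linarith
  · simp only [Nat.cast_zero, sub_zero]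
    rw [hEX]
    linarith
  · intro a ha
    rw [Nat.cast_zero, sub_zero] at ha
    refine isGood_of_le (s := X a) (Or.inl ?_) ha
    have h1 : ((G.down L v).filter fun u => G.kept L a u ≠ none).card ≤
        ((G.down L v).filter fun u => ¬ a u = none).card := by
      refine Finset.card_le_card fun u hu => ?_
      obtain ⟨hu, hk⟩ := Finset.mem_filter.1 hu
      obtain ⟨c, hc⟩ := Option.ne_none_iff_exists'.1 hk
      exact Finset.mem_filter.2 ⟨hu, by simp [(kept_eq_some.1 hc).1]⟩
    have h2 := Finset.card_filter_add_card_filter_not (s := G.down L v) (fun u => a u = none)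
    change _ + Finset.card _ ≤ _
    omega

end SimpleGraph

/-! ### Savings from colors outside the list and from repeated colors. -/

namespace SimpleGraph

open FiniteProduct

variable {V C : Type*} [Fintype V] [DecidableEq V] [DecidableEq C]
variable {G : SimpleGraph V} [DecidableRel G.Adj] {L : V → Finset C} [Fintype C]

theorem card_pair_le (u w : V) : ({u, w} : Finset V).card ≤ 3 :=
  (Finset.card_insert_le _ _).trans (by simp)

theorem card_triple_le (x u w : V) : ({x, u, w} : Finset V).card ≤ 3 :=
  (Finset.card_insert_le _ _).trans (Nat.succ_le_succ ((Finset.card_insert_le _ _).trans (by simp)))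

/-- The probability that the vertices of `A` get the color `c` and no conflict arises. -/
theorem le_prob_assign (hw : IsWeight (listWeight L)) {A T : Finset V} {c : C} {r : ℝ}
    (hr : r ≤ ∏ x ∈ T, (1 - listWeight L x (some c))) :
    (∏ x ∈ A, listWeight L x (some c)) * r ≤
      prob (listWeight L) {a | (∀ x ∈ A, a x = some c) ∧ ∀ x ∈ T \ A, a x ≠ some c} := by
  rw [prob_assign hw Finset.disjoint_sdiff]
  refine mul_le_mul_of_nonneg_left (hr.trans ?_) (Finset.prod_nonneg fun x _ => hw.nonneg _ _)
  exact prod_le_prod_of_subset_of_le_one Finset.sdiff_subset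
    (fun x => sub_nonneg.2 (hw.le_one _ _)) fun x => sub_le_self _ (hw.nonneg _ _)

theorem prob_not_isGood_le_of_outsideMass (hL : ∀ v, 0 < (L v).card) (hLL : G.HasLongLists L)
    (h1000 : ∀ v, 1000 ≤ (L v).card) {v : V} {Δ : ℕ} {R : ℝ}
    (hΔ : G.degree v ≤ Δ) (hR : 1000000 ≤ R) (hRg : R ≤ G.gap v)
    (hmass : 0.017 * G.gap v ≤ G.outsideMass L v) :
    prob (listWeight L) {a | ¬ G.IsGood L a v} ≤ 2 * (Δ + 1) * Real.exp (-(R / 10 ^ 12)) := by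
  classical
  have hw := isWeight_listWeight hL
  have hsave := save_le_gap hLL v
  let 𝓕 : Set (Finset V) := {T | ∃ u ∈ G.up L v, T = {u}}
  let 𝓖 : Set (Finset V) := {T | ∃ u ∈ G.up L v, ∃ x ∈ G.up L u, T = {x, u}}
  have h𝓖𝓕 : ∀ T ∈ 𝓖, ∃ T' ∈ 𝓕, T' ⊆ T := by
    rintro T ⟨u, hu, x, hx, rfl⟩
    exact ⟨{u}, ⟨u, hu, rfl⟩, by simp⟩
  set S : Finset C := Finset.univ \ L v with hS
  have hmemF : ∀ (c : C) (a : V → Option C), (∃ T ∈ 𝓕, ∀ i ∈ T, a i = some c) ↔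
      ∃ u ∈ G.up L v, a u = some c := by
    intro c a
    constructor
    · rintro ⟨_, ⟨u, hu, rfl⟩, h⟩
      exact ⟨u, hu, h u (by simp)⟩
    · rintro ⟨u, hu, h⟩
      exact ⟨{u}, ⟨u, hu, rfl⟩, by simpa using h⟩
  have hmemG : ∀ (c : C) (a : V → Option C), (∃ T ∈ 𝓖, ∀ i ∈ T, a i = some c) ↔
      ∃ u ∈ G.up L v, ∃ x ∈ G.up L u, a x = some c ∧ a u = some c := by
    intro c a
    constructor
    · rintro ⟨_, ⟨u, hu, x, hx, rfl⟩, h⟩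
      exact ⟨u, hu, x, hx, h x (by simp), h u (by simp)⟩
    · rintro ⟨u, hu, x, hx, h⟩
      exact ⟨{x, u}, ⟨u, hu, x, hx, rfl⟩, by simpa using h⟩
  have hsumW : ∑ c ∈ S, ∑ u ∈ G.up L v, listWeight L u (some c) = G.outsideMass L v / 2 := by
    rw [Finset.sum_comm, outsideMass, Finset.sum_div]
    refine Finset.sum_congr rfl fun u _ => ?_
    have : S ∩ L u = L u \ L v := by
      ext c
      simp [hS, and_comm]
    simp only [listWeight, Finset.sum_ite_mem, this, Finset.sum_const, nsmul_eq_mul]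
    ring
  refine prob_not_isGood_le_of_expect hL (X := monoCount S 𝓕) (Y := monoCount S 𝓖)
    (M := G.outsideMass L v) (certifiable_monoCount S ?_) (certifiable_monoCount S ?_) ?_
    (monoCount_mono h𝓖𝓕) ?_ ?_ ?_ hR (by linarith)
  · rintro T ⟨u, hu, rfl⟩
    simp
  · rintro T ⟨u, hu, x, hx, rfl⟩
    exact card_pair_le x u
  · intro a
    refine le_trans ?_ ((Finset.card_le_card (up_subset (L := L) v)).trans
      ((G.card_neighborFinset_eq_degree v).le.trans hΔ))
    rw [monoCount_eq_card, ← Finset.card_image_of_injective _ (Option.some_injective C)]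
    refine (Finset.card_le_card ?_).trans (Finset.card_image_le (f := a))
    intro o ho
    obtain ⟨c, hc, rfl⟩ := Finset.mem_image.1 ho
    obtain ⟨u, hu, huc⟩ := (hmemF c a).1 (Finset.mem_filter.1 hc).2
    exact Finset.mem_image.2 ⟨u, hu, huc⟩
  · have hle : ∀ a, (monoCount S 𝓕 a : ℝ) ≤
        ∑ c ∈ S, ∑ u ∈ G.up L v, if a u = some c then (1 : ℝ) else 0 := by
      intro a
      rw [monoCount_eq_sum]
      refine Finset.sum_le_sum fun c _ => ?_
      rw [Finset.sum_boole]
      split_ifs with h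
      · obtain ⟨u, hu, huc⟩ := (hmemF c a).1 h
        exact_mod_cast Finset.card_pos.2 ⟨u, Finset.mem_filter.2 ⟨hu, huc⟩⟩
      · positivity
    refine (expect_mono hw hle).trans ?_
    simp only [expect_sum]
    have hone : ∀ c u, expect (listWeight L) (fun a => if a u = some c then (1 : ℝ) else 0) =
        listWeight L u (some c) := by
      intro c u
      rw [expect_ite_eq_prob]
      simpa using prob_assign hw (A := {u}) (T := ∅) (by simp) (some c)
    simp only [hone, hsumW]
    have : 0 ≤ G.outsideMass L v := by linarith
    linarith
  -- Requiring u to be the only vertex of `up v ∪ up u` with color c makes these events disjoint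
  -- over u and rules out every conflict counted by `𝓖`. Its conditional probability is at least
  -- 0.6016² ≥ 0.36192; half of this times 0.017, less the margin, barely exceeds 1/330.
  · let Q : C → V → (V → Option C) → Prop := fun c u a =>
      (∀ x ∈ ({u} : Finset V), a x = some c) ∧
        ∀ x ∈ (G.up L v ∪ G.up L u) \ {u}, a x ≠ some c
    have hF : ∀ a, ∑ c ∈ S, (∑ u ∈ G.up L v, if Q c u a then (1 : ℝ) else 0) ≤
        (monoCount S 𝓕 a : ℝ) - monoCount S 𝓖 a := by
      intro a
      refine le_monoCount_sub (F := fun c a => ∑ u ∈ G.up L v, if Q c u a then (1 : ℝ) else 0)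
        (fun c _ => ?_) h𝓖𝓕
      rw [Finset.sum_boole, hmemF, hmemG]
      rcases ((G.up L v).filter fun u => Q c u a).eq_empty_or_nonempty with h0 | ⟨u, hu⟩
      · left
        simp [h0]
      right
      obtain ⟨hu, hQ⟩ := Finset.mem_filter.1 hu
      have huc : a u = some c := hQ.1 u (by simp)
      have hother : ∀ x, x ∈ G.up L v ∪ G.up L u → a x = some c → x = u := by
        intro x hx hxc
        by_contra hxu
        exact hQ.2 x (by simp [hxu, Finset.mem_union.1 hx]) hxc
      refine ⟨?_, ⟨u, hu, huc⟩, ?_⟩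
      · have : ((G.up L v).filter fun u => Q c u a) ⊆ {u} := by
          intro w hw
          obtain ⟨hw, hQw⟩ := Finset.mem_filter.1 hw
          exact Finset.mem_singleton.2
            (hother w (Finset.mem_union_left _ hw) (hQw.1 w (by simp)))
        exact_mod_cast Finset.card_le_card this
      · rintro ⟨w, hw, x, hx, hxc, hwc⟩
        obtain rfl := hother w (Finset.mem_union_left _ hw) hwc
        obtain rfl := hother x (Finset.mem_union_right _ hx) hxc
        exact G.irrefl (mem_up.1 hx).1
    refine le_trans ?_ (expect_mono hw hF)
    simp only [expect_sum]
    have hone : ∀ c u, listWeight L u (some c) * 0.36192 ≤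
        expect (listWeight L) (fun a => if Q c u a then (1 : ℝ) else 0) := by
      intro c u
      rw [expect_ite_eq_prob]
      have h1 := le_prob_assign hw (A := {u}) (T := G.up L v ∪ G.up L u) (c := c) (r := 0.36192) (by
        refine le_trans ?_ (prod_mul_prod_le_prod_union _ _
          (fun x => sub_nonneg.2 (hw.le_one _ _)) fun x => sub_le_self _ (hw.nonneg _ _))
        have h2 := le_prod_up hLL (h1000 v) (Finset.Subset.refl _) c
        have h3 := le_prod_up hLL (h1000 u) (Finset.Subset.refl _) c
        have h4 := mul_le_mul h2 h3 (by norm_num) (by linarith)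
        norm_num at h4 ⊢
        linarith)
      rwa [Finset.prod_singleton] at h1
    have h1 : ∑ c ∈ S, ∑ u ∈ G.up L v, listWeight L u (some c) * 0.36192 ≤ ∑ c ∈ S,
        ∑ u ∈ G.up L v, expect (listWeight L) (fun a => if Q c u a then (1 : ℝ) else 0) :=
      Finset.sum_le_sum fun c _ => Finset.sum_le_sum fun u _ => hone c u
    simp only [← Finset.sum_mul] at h1
    rw [hsumW] at h1
    linarith
  · intro a ha
    obtain ⟨P, hPS, hP, hPcard⟩ := exists_monoCount_sub_le S 𝓕 𝓖 a
    refine isGood_of_le (s := P.card) (Or.inr (card_keptColors_add_le fun c hc => ?_))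
      (ha.trans hPcard)
    obtain ⟨hcF, hcG⟩ := hP c hc
    rw [hmemF] at hcF
    rw [hmemG] at hcG
    obtain ⟨u, hu, huc⟩ := hcF
    left
    refine ⟨(Finset.mem_sdiff.1 (hPS hc)).2, u, up_subset v hu, kept_eq_some.2 ⟨huc, ?_⟩⟩
    exact fun x hx hxc => hcG ⟨u, hu, x, hx, hxc, huc⟩

/-- Two vertices of `similar v` have many common colors with `v`. -/
theorem le_card_inter_div {u w v : V} (hv : 0 < (L v).card) (hu : u ∈ G.similar L v)
    (hw : w ∈ G.similar L v) :
    0.8 / (L v).card ≤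
      ((L v ∩ (L u ∩ L w)).card : ℝ) * (1 / (2 * (L u).card) * (1 / (2 * (L w).card))) * 4 := by
  have hl : (0 : ℝ) < (L v).card := by exact_mod_cast hv
  have hsub : L v \ (L v ∩ (L u ∩ L w)) ⊆ (L v \ L u) ∪ (L v \ L w) := by
    intro c hc
    simp only [Finset.mem_sdiff, Finset.mem_inter, Finset.mem_union] at hc ⊢
    tauto
  have h1 := (Finset.card_le_card hsub).trans (Finset.card_union_le _ _)
  have h2 := Finset.card_sdiff_add_card_eq_card
    (Finset.inter_subset_left : L v ∩ (L u ∩ L w) ⊆ L v)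
  have h3 := fun x => Finset.card_sdiff_add_card (L v) (L x)
  have h4 := fun x => Finset.card_sdiff_add_card (L x) (L v)
  have h5 : ∀ x, (L v \ L x).card + (L x).card = (L x \ L v).card + (L v).card := fun x => by
    rw [h3, h4, Finset.union_comm]
  have h6 : ∀ x, ((L v \ L x).card : ℝ) + (L x).card = (L x \ L v).card + (L v).card :=
    fun x => by exact_mod_cast h5 x
  have hu1 := h6 u
  have hw1 := h6 w
  have hu2 : (10 : ℝ) * (L u \ L v).card ≤ (L u).card := by exact_mod_cast (mem_similar.1 hu).2
  have hw2 : (10 : ℝ) * (L w \ L v).card ≤ (L w).card := by exact_mod_cast (mem_similar.1 hw).2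
  have hu3 : ((L v).card : ℝ) ≤ (L u).card :=
    Nat.cast_le.2 (mem_up.1 (mem_similar.1 hu).1).2
  have hw3 : ((L v).card : ℝ) ≤ (L w).card :=
    Nat.cast_le.2 (mem_up.1 (mem_similar.1 hw).1).2
  have hu4 := card_le_card_add_card_sdiff (L := L) u v
  have hw4 := card_le_card_add_card_sdiff (L := L) w v
  have h7 : ((L v).card : ℝ) ≤
      (L v ∩ (L u ∩ L w)).card + ((L v \ L u).card + (L v \ L w).card) := by
    have : (L v).card ≤
      (L v ∩ (L u ∩ L w)).card + ((L v \ L u).card + (L v \ L w).card) := by omega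
    exact_mod_cast this
  generalize ((L v ∩ (L u ∩ L w)).card : ℝ) = y at *
  generalize ((L v).card : ℝ) = l at *
  generalize ((L u).card : ℝ) = a at *
  generalize ((L w).card : ℝ) = b at *
  have ha : 0 < a := hl.trans_le hu3
  have hb : 0 < b := hl.trans_le hw3
  have h8 : 0.9 * (a + b) - l ≤ y := by linarith
  have h9 : y * (1 / (2 * a) * (1 / (2 * b))) * 4 = y / (a * b) := by
    field_simp
    norm_num
  rw [h9, div_le_div_iff₀ hl (by positivity)]
  have h10 : 9 * (a - l) ≤ l := by linarith
  have h11 : 9 * (b - l) ≤ l := by linarith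
  nlinarith [mul_le_mul_of_nonneg_right h8 hl.le,
    mul_le_mul_of_nonneg_right h10 (sub_nonneg.2 hw3),
    mul_le_mul_of_nonneg_right h11 (sub_nonneg.2 hu3),
    mul_nonneg hl.le (sub_nonneg.2 hw3), mul_nonneg hl.le (sub_nonneg.2 hu3)]

theorem listWeight_mul_le {u w v : V} (hv : 0 < (L v).card) (hu : u ∈ G.similar L v)
    (hw : w ∈ G.similar L v) :
    ∑ c ∈ L v, listWeight L u (some c) * listWeight L w (some c) ≤ 1 / (4 * (L v).card) := by
  have hl : (0 : ℝ) < (L v).card := by exact_mod_cast hv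
  have key : ∀ x ∈ G.similar L v, ∀ c, 0 ≤ listWeight L x (some c) ∧
      listWeight L x (some c) ≤ 1 / (2 * (L v).card) := by
    intro x hx c
    have h1 : ((L v).card : ℝ) ≤ (L x).card := Nat.cast_le.2 (mem_up.1 (mem_similar.1 hx).1).2
    simp only [listWeight]
    split_ifs
    · exact ⟨by positivity, one_div_le_one_div_of_le (by linarith) (by linarith)⟩
    · exact ⟨le_rfl, by positivity⟩
  calc _ ≤ ∑ c ∈ L v, 1 / (2 * ((L v).card : ℝ)) * (1 / (2 * (L v).card)) :=
        Finset.sum_le_sum fun c _ => mul_le_mul (key u hu c).2 (key w hw c).2 (key w hw c).1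
          (by positivity)
    _ = _ := by
        rw [Finset.sum_const, nsmul_eq_mul]
        field_simp
        norm_num

/-- Two similar neighbors receive the same color of L(v) with probability at least 0.2/|L(v)|,
within a constant factor of the upper bound in `listWeight_mul_le`. The factor 4 in
`le_card_inter_div` cancels the two activation probabilities 1/2. -/
theorem le_listWeight_mul {u w v : V} (hv : 0 < (L v).card) (hu : u ∈ G.similar L v)
    (hw : w ∈ G.similar L v) :
    0.2 / (L v).card ≤ ∑ c ∈ L v, listWeight L u (some c) * listWeight L w (some c) := by
  have h1 := le_card_inter_div hv hu hw
  have h2 : ∀ c, listWeight L u (some c) * listWeight L w (some c) =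
      if c ∈ L u ∩ L w then 1 / (2 * ((L u).card : ℝ)) * (1 / (2 * (L w).card)) else 0 := by
    intro c
    by_cases hcu : c ∈ L u <;> by_cases hcw : c ∈ L w <;> simp [listWeight, hcu, hcw]
  simp only [h2, Finset.sum_ite_mem, Finset.sum_const, nsmul_eq_mul]
  have h3 : (0.2 : ℝ) / (L v).card = 0.8 / (L v).card / 4 := by ring
  rw [h3]
  linarith

theorem prob_not_isGood_le_of_numNonAdj (hL : ∀ v, 0 < (L v).card) (hLL : G.HasLongLists L)
    (h1000 : ∀ v, 1000 ≤ (L v).card) {v : V} {Δ : ℕ} {R : ℝ} (hld : (L v).card ≤ G.degree v)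
    (hΔ : G.degree v ≤ Δ) (hR : 1000000 ≤ R) (hRg : R ≤ G.gap v)
    (hnon : 0.15 * G.gap v * G.degree v ≤ G.numNonAdj (G.similar L v)) :
    prob (listWeight L) {a | ¬ G.IsGood L a v} ≤ 2 * (Δ + 1) * Real.exp (-(R / 10 ^ 12)) := by
  classical
  have hw := isWeight_listWeight hL
  have hsave := save_le_gap hLL v
  have hl : (0 : ℝ) < (L v).card := by exact_mod_cast hL v
  set E := G.similar L v with hE
  let 𝓕 : Set (Finset V) := {T | ∃ u ∈ E, ∃ w ∈ G.nonNbr E u, T = {u, w}}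
  let 𝓖 : Set (Finset V) := {T | ∃ u ∈ E, ∃ w ∈ G.nonNbr E u, ∃ x ∈ G.up L u, T = {x, u, w}}
  have h𝓖𝓕 : ∀ T ∈ 𝓖, ∃ T' ∈ 𝓕, T' ⊆ T := by
    rintro T ⟨u, hu, w, hw, x, hx, rfl⟩
    exact ⟨{u, w}, ⟨u, hu, w, hw, rfl⟩, by simp⟩
  have hmemF : ∀ (c : C) (a : V → Option C), (∃ T ∈ 𝓕, ∀ i ∈ T, a i = some c) ↔
      ∃ u ∈ E, ∃ w ∈ G.nonNbr E u, a u = some c ∧ a w = some c := by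
    intro c a
    constructor
    · rintro ⟨_, ⟨u, hu, w, hw, rfl⟩, h⟩
      exact ⟨u, hu, w, hw, h u (by simp), h w (by simp)⟩
    · rintro ⟨u, hu, w, hw, h⟩
      exact ⟨{u, w}, ⟨u, hu, w, hw, rfl⟩, by simpa using h⟩
  have hmemG : ∀ (c : C) (a : V → Option C), (∃ T ∈ 𝓖, ∀ i ∈ T, a i = some c) ↔
      ∃ u ∈ E, ∃ w ∈ G.nonNbr E u, ∃ x ∈ G.up L u,
        a x = some c ∧ a u = some c ∧ a w = some c := by
    intro c a
    constructor
    · rintro ⟨_, ⟨u, hu, w, hw, x, hx, rfl⟩, h⟩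
      exact ⟨u, hu, w, hw, x, hx, h x (by simp), h u (by simp), h w (by simp)⟩
    · rintro ⟨u, hu, w, hw, x, hx, h⟩
      exact ⟨{x, u, w}, ⟨u, hu, w, hw, x, hx, rfl⟩, by simpa using h⟩
  have hnonmem : ∀ {u w : V}, w ∈ G.nonNbr E u ↔ w ∈ E ∧ w ≠ u ∧ ¬ G.Adj u w := by
    intro u w
    simp [nonNbr]
  let P := E.sigma fun u => G.nonNbr E u
  have hPmem : ∀ p : (_ : V) × V, p ∈ P ↔ p.1 ∈ E ∧ p.2 ∈ G.nonNbr E p.1 := fun p =>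
    Finset.mem_sigma
  have hPcard : (P.card : ℝ) = G.numNonAdj E := by
    rw [Finset.card_sigma, numNonAdj]
  have hPE : ∀ p ∈ P, p.1 ∈ E ∧ p.2 ∈ E := fun p hp =>
    ⟨((hPmem p).1 hp).1, (hnonmem.1 ((hPmem p).1 hp).2).1⟩
  set T : ℝ := (G.numNonAdj E : ℝ) with hT
  have hTl : 0.15 * G.gap v ≤ T / (L v).card := by
    rw [le_div_iff₀ hl]
    have h1 : ((L v).card : ℝ) ≤ G.degree v := Nat.cast_le.2 hld
    have h2 := mul_le_mul_of_nonneg_left h1 (show 0 ≤ 0.15 * G.gap v by linarith)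
    linarith
  have hfour : T / (L v).card = 4 * (T * (1 / (4 * (L v).card))) := by
    field_simp
  refine prob_not_isGood_le_of_expect hL (X := monoCount (L v) 𝓕) (Y := monoCount (L v) 𝓖)
    (M := T * (1 / (4 * (L v).card))) (certifiable_monoCount _ ?_) (certifiable_monoCount _ ?_) ?_
    (monoCount_mono h𝓖𝓕) ?_ ?_ ?_ hR (by linarith)
  · rintro T ⟨u, hu, w, hw, rfl⟩
    exact card_pair_le u w
  · rintro T ⟨u, hu, w, hw, x, hx, rfl⟩
    exact card_triple_le x u w
  · intro a
    refine le_trans ?_ (hld.trans hΔ)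
    rw [monoCount_eq_card]
    exact Finset.card_filter_le _ _
  · have hle : ∀ a, (monoCount (L v) 𝓕 a : ℝ) ≤
        ∑ c ∈ L v, ∑ p ∈ P, if a p.1 = some c ∧ a p.2 = some c then (1 : ℝ) else 0 := by
      intro a
      rw [monoCount_eq_sum]
      refine Finset.sum_le_sum fun c _ => ?_
      rw [Finset.sum_boole]
      split_ifs with h
      · obtain ⟨u, hu, w, hw, h1⟩ := (hmemF c a).1 h
        exact_mod_cast Finset.card_pos.2 ⟨(⟨u, w⟩ : (_ : V) × V),
          Finset.mem_filter.2 ⟨(hPmem ⟨u, w⟩).2 ⟨hu, hw⟩, h1⟩⟩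
      · positivity
    refine (expect_mono hw hle).trans ?_
    simp only [expect_sum]
    rw [Finset.sum_comm]
    have hone : ∀ p ∈ P, ∑ c ∈ L v, expect (listWeight L)
        (fun a => if a p.1 = some c ∧ a p.2 = some c then (1 : ℝ) else 0) ≤
        1 / (4 * (L v).card) := by
      intro p hp
      refine le_trans (Finset.sum_le_sum fun c _ => ?_)
        (listWeight_mul_le (hL v) (hPE p hp).1 (hPE p hp).2)
      rw [expect_ite_eq_prob]
      have hne : p.1 ≠ p.2 := (hnonmem.1 ((hPmem p).1 hp).2).2.1.symm
      have := prob_assign hw (A := {p.1, p.2}) (T := ∅) (by simp) (some c)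
      rw [Finset.prod_pair hne] at this
      simpa using this.le
    refine (Finset.sum_le_card_nsmul _ _ _ hone).trans ?_
    rw [nsmul_eq_mul, hPcard]
  -- Excluding c from the rest of `E` leaves only the two orderings of one pair, hence the factor
  -- 1/2 below. Excluding it from both `up` sets removes every conflict. Three such exclusions cost
  -- 0.6016³ ≥ 0.217.
  · let Q : C → (_ : V) × V → (V → Option C) → Prop := fun c p a =>
      (∀ x ∈ ({p.1, p.2} : Finset V), a x = some c) ∧
        ∀ x ∈ (E ∪ (G.up L p.1 ∪ G.up L p.2)) \ {p.1, p.2}, a x ≠ some c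
    have hF : ∀ a, ∑ c ∈ L v, (1 / 2 * ∑ p ∈ P, if Q c p a then (1 : ℝ) else 0) ≤
        (monoCount (L v) 𝓕 a : ℝ) - monoCount (L v) 𝓖 a := by
      intro a
      refine le_monoCount_sub (F := fun c a => 1 / 2 * ∑ p ∈ P, if Q c p a then (1 : ℝ) else 0)
        (fun c _ => ?_) h𝓖𝓕
      rw [Finset.sum_boole, hmemF, hmemG]
      rcases (P.filter fun p => Q c p a).eq_empty_or_nonempty with h0 | ⟨⟨u, w⟩, hp⟩
      · left
        simp [h0]
      right
      obtain ⟨hp, hQ⟩ := Finset.mem_filter.1 hp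
      obtain ⟨hu, hw⟩ := (hPmem ⟨u, w⟩).1 hp
      have huc : a u = some c := hQ.1 u (by simp)
      have hwc : a w = some c := hQ.1 w (by simp)
      have hother : ∀ x, x ∈ E ∪ (G.up L u ∪ G.up L w) → a x = some c → x = u ∨ x = w := by
        intro x hx hxc
        by_contra hxu
        exact hQ.2 x (Finset.mem_sdiff.2 ⟨hx, by simpa using hxu⟩) hxc
      have hnadj : ¬ G.Adj u w := (hnonmem.1 hw).2.2
      refine ⟨?_, ⟨u, hu, w, hw, huc, hwc⟩, ?_⟩
      · have : (P.filter fun p => Q c p a) ⊆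
            ({⟨u, w⟩, ⟨w, u⟩} : Finset ((_ : V) × V)) := by
          rintro ⟨x, y⟩ hxy
          obtain ⟨hxy, hQ'⟩ := Finset.mem_filter.1 hxy
          have hne : y ≠ x := (hnonmem.1 ((hPmem ⟨x, y⟩).1 hxy).2).2.1
          obtain ⟨hxE, hyE⟩ := hPE _ hxy
          have h1 := hother x (Finset.mem_union_left _ hxE) (hQ'.1 x (by simp))
          have h2 := hother y (Finset.mem_union_left _ hyE) (hQ'.1 y (by simp))
          rcases h1 with rfl | rfl <;> rcases h2 with rfl | rfl
          · exact (hne rfl).elim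
          · simp
          · simp
          · exact (hne rfl).elim
        have h1 : ((P.filter fun p => Q c p a).card : ℝ) ≤ 2 := by
          exact_mod_cast (Finset.card_le_card this).trans Finset.card_le_two
        linarith
      · rintro ⟨u', hu', w', hw', x, hx, hxc, huc', hwc'⟩
        have h1 := hother u' (Finset.mem_union_left _ hu') huc'
        have hxu : x ∈ E ∪ (G.up L u ∪ G.up L w) := by
          rcases h1 with rfl | rfl
          · exact Finset.mem_union_right _ (Finset.mem_union_left _ hx)
          · exact Finset.mem_union_right _ (Finset.mem_union_right _ hx)
        have h2 := hother x hxu hxc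
        have h3 := (mem_up.1 hx).1
        rcases h1 with rfl | rfl <;> rcases h2 with rfl | rfl
        · exact G.irrefl h3
        · exact hnadj h3
        · exact hnadj h3.symm
        · exact G.irrefl h3
    refine le_trans ?_ (expect_mono hw hF)
    simp only [expect_sum, expect_mul_left]
    rw [← Finset.mul_sum, Finset.sum_comm]
    have hone : ∀ p ∈ P, 0.0434 / ((L v).card : ℝ) ≤
        ∑ c ∈ L v, expect (listWeight L) (fun a => if Q c p a then (1 : ℝ) else 0) := by
      intro p hp
      have h0 := le_listWeight_mul (hL v) (hPE p hp).1 (hPE p hp).2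
      have h1 : ∑ c ∈ L v, listWeight L p.1 (some c) * listWeight L p.2 (some c) * 0.217 ≤
          ∑ c ∈ L v, expect (listWeight L) (fun a => if Q c p a then (1 : ℝ) else 0) := by
        refine Finset.sum_le_sum fun c _ => ?_
        rw [expect_ite_eq_prob]
        have hne : p.1 ≠ p.2 := (hnonmem.1 ((hPmem p).1 hp).2).2.1.symm
        have h2 := le_prob_assign hw (A := {p.1, p.2}) (T := E ∪ (G.up L p.1 ∪ G.up L p.2))
          (c := c) (r := 0.217) (by
            have hnn : ∀ x, 0 ≤ 1 - listWeight L x (some c) := fun x =>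
              sub_nonneg.2 (hw.le_one _ _)
            have hle : ∀ x, 1 - listWeight L x (some c) ≤ 1 := fun x =>
              sub_le_self _ (hw.nonneg _ _)
            refine le_trans ?_ (prod_mul_prod_le_prod_union _ _ hnn hle)
            have h3 := le_prod_up hLL (h1000 v) (S := E) (Finset.filter_subset _ _) c
            have h4 := le_prod_up hLL (h1000 p.1) (Finset.Subset.refl _) c
            have h5 := le_prod_up hLL (h1000 p.2) (Finset.Subset.refl _) c
            have h6 := (mul_le_mul h4 h5 (by norm_num) (by linarith)).trans
              (prod_mul_prod_le_prod_union _ _ hnn hle)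
            have h7 := mul_le_mul h3 h6 (by norm_num) (by linarith)
            norm_num at h7 ⊢
            linarith)
        rwa [Finset.prod_pair hne] at h2
      rw [← Finset.sum_mul] at h1
      have h2 : 0.0434 / ((L v).card : ℝ) = 0.2 / (L v).card * 0.217 := by ring
      rw [h2]
      linarith
    have h1 := Finset.card_nsmul_le_sum P _ _ hone
    rw [nsmul_eq_mul, hPcard] at h1
    have h2 : T * (0.0434 / ((L v).card : ℝ)) = 0.0434 * (T / (L v).card) := by ring
    rw [h2] at h1
    linarith
  · intro a ha
    obtain ⟨P', hPS, hP', hPcard'⟩ := exists_monoCount_sub_le (L v) 𝓕 𝓖 a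
    refine isGood_of_le (s := P'.card) (Or.inr (card_keptColors_add_le fun c hc => ?_))
      (ha.trans hPcard')
    obtain ⟨hcF, hcG⟩ := hP' c hc
    rw [hmemF] at hcF
    rw [hmemG] at hcG
    obtain ⟨u, hu, w, hw, huc, hwc⟩ := hcF
    obtain ⟨hwE, hwu, hnadj⟩ := hnonmem.1 hw
    -- A triple in `𝓖` records a conflict at its first vertex only; reversing the pair covers
    -- conflicts at the other.
    have hw' : u ∈ G.nonNbr E w := hnonmem.2 ⟨hu, hwu.symm, fun h => hnadj h.symm⟩
    have hN : ∀ x ∈ E, x ∈ G.neighborFinset v := fun x hx => up_subset v (mem_similar.1 hx).1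
    right
    refine ⟨hPS hc, u, hN u hu, w, hN w hwE, hwu.symm, kept_eq_some.2 ⟨huc, ?_⟩,
      kept_eq_some.2 ⟨hwc, ?_⟩⟩
    · exact fun x hx hxc => hcG ⟨u, hu, w, hw, x, hx, hxc, huc, hwc⟩
    · exact fun x hx hxc => hcG ⟨w, hwE, u, hw', x, hx, hxc, hwc, huc⟩

end SimpleGraph

/-! ### Excluding critical graphs and conclusion. -/

namespace SimpleGraph

open FiniteProduct

/-- There is no critical graph with long lists. -/
theorem not_isListCritical {V C : Type*} [Fintype V] [DecidableEq V] [DecidableEq C] [Fintype C]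
    {G : SimpleGraph V} [DecidableRel G.Adj] {L : V → Finset C} {Δ : ℕ} {R : ℝ}
    (hΔ : ∀ v, G.degree v ≤ Δ) (hR : 1000000 ≤ R)
    (hRΔ : 8 * ((Δ : ℝ) + 1) ^ 5 ≤ Real.exp (R / 10 ^ 12))
    (hω : ∀ v, (G.cliqueNumAt v : ℝ) + R ≤ (L v).card) (hL : G.HasLongLists L) :
    ¬ G.IsListCritical L := by
  intro h
  have h1000 : ∀ v, 1000 ≤ (L v).card := fun v => by
    have h1 := hω v
    have h2 : (0 : ℝ) ≤ G.cliqueNumAt v := Nat.cast_nonneg _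
    have h3 : (1000 : ℝ) ≤ (L v).card := by linarith
    exact_mod_cast h3
  have hpos : ∀ v, 0 < (L v).card := fun v => (by norm_num : 0 < 1000).trans_le (h1000 v)
  have hw := isWeight_listWeight hpos
  have hbad : ∀ v, prob (listWeight L) {a | ¬ G.IsGood L a v} ≤
      2 * (Δ + 1) * Real.exp (-(R / 10 ^ 12)) := by
    intro v
    have hld := h.card_le_degree v
    have hRg : R ≤ G.gap v := by
      have h1 : ((L v).card : ℝ) ≤ G.degree v := by exact_mod_cast hld
      have h2 := hω v
      rw [gap]
      linarith
    rcases h.saving_cases hL v (by linarith [hω v]) with h1 | h1 | h1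
    · exact prob_not_isGood_le_of_down hpos (hΔ v) hR hRg (save_le_gap hL v) h1
    · exact prob_not_isGood_le_of_outsideMass hpos hL h1000 (hΔ v) hR hRg h1
    · exact prob_not_isGood_le_of_numNonAdj hpos hL h1000 hld (hΔ v) hR hRg h1
  have hΔ0 : (0 : ℝ) ≤ Δ := Nat.cast_nonneg _
  -- The local lemma condition 4Dq ≤ 1 with D = (Δ + 1)^4, since balls of radius two have at most (Δ
  -- + 1)² vertices; `hRΔ` is exactly this requirement.
  have hq : 4 * ((Δ : ℝ) + 1) ^ 4 * (2 * (Δ + 1) * Real.exp (-(R / 10 ^ 12))) ≤ 1 := by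
    rw [Real.exp_neg]
    calc _ = 8 * ((Δ : ℝ) + 1) ^ 5 * (Real.exp (R / 10 ^ 12))⁻¹ := by ring
      _ ≤ Real.exp (R / 10 ^ 12) * (Real.exp (R / 10 ^ 12))⁻¹ :=
          mul_le_mul_of_nonneg_right hRΔ (inv_nonneg.2 (Real.exp_pos _).le)
      _ = 1 := mul_inv_cancel₀ (Real.exp_pos _).ne'
  obtain ⟨a, ha, hgood⟩ := exists_avoiding hw (fun v => {a | ¬ G.IsGood L a v}) G.ballTwo
    (2 * (Δ + 1) * Real.exp (-(R / 10 ^ 12))) ((Δ + 1) ^ 4)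
    (fun v a b hab => not_congr (isGood_congr hab)) hbad
    (fun v => ncard_not_disjoint_ballTwo_le hΔ v) (by push_cast; exact hq) (by
      have h1 : (1 : ℝ) ≤ ((Δ : ℝ) + 1) ^ 4 := one_le_pow₀ (by linarith)
      have h2 : 0 ≤ 2 * ((Δ : ℝ) + 1) * Real.exp (-(R / 10 ^ 12)) := by positivity
      nlinarith)
  exact h.not_colorable (listColorable_of_isGood (fun v c => mem_of_weight_ne_zero ha)
    fun v => not_not.1 (hgood v))

theorem cliqueNumAt_induce_le {V : Type*} [Finite V] (G : SimpleGraph V) (s : Set V) (v : s) :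
    (G.induce s).cliqueNumAt v ≤ G.cliqueNumAt v := by
  classical
  obtain ⟨K, hK, hv⟩ := ((G.induce s).isGreatest_cliqueNumAt v).1
  refine (G.isGreatest_cliqueNumAt v).2 ⟨K.map (Function.Embedding.subtype _), ?_, by simpa using hv⟩
  refine ⟨?_, by rw [Finset.card_map, hK.2]⟩
  intro x hx y hy hxy
  obtain ⟨x', hx', rfl⟩ := Finset.mem_map.1 (Finset.mem_coe.1 hx)
  obtain ⟨y', hy', rfl⟩ := Finset.mem_map.1 (Finset.mem_coe.1 hy)
  exact hK.1 (Finset.mem_coe.2 hx') (Finset.mem_coe.2 hy') fun h => hxy (congrArg _ h)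

theorem degree_induce_le {V : Type*} [Fintype V] (G : SimpleGraph V) [DecidableRel G.Adj]
    (s : Set V) [Fintype s] [DecidableRel (G.induce s).Adj] (v : s) :
    (G.induce s).degree v ≤ G.degree v := by
  rw [← card_neighborFinset_eq_degree, ← card_neighborFinset_eq_degree,
    ← Finset.card_map (Function.Embedding.subtype _)]
  refine Finset.card_le_card fun x hx => ?_
  obtain ⟨y, hy, rfl⟩ := Finset.mem_map.1 hx
  simpa using hy

/-- Degrees and clique numbers do not increase in induced subgraphs, so for fixed `Δ` and `R` the
hypotheses are hereditary and a smallest counterexample is critical. A term tied to the maximum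
degree of each subgraph would not stay fixed in this way. -/
theorem listColorable_of_long_lists {C : Type*} [DecidableEq C] [Fintype C] {Δ : ℕ} {R : ℝ}
    (hR : 1000000 ≤ R) (hRΔ : 8 * ((Δ : ℝ) + 1) ^ 5 ≤ Real.exp (R / 10 ^ 12)) (n : ℕ) :
    ∀ (V : Type*) [Fintype V] (G : SimpleGraph V) [DecidableRel G.Adj] (L : V → Finset C),
    Fintype.card V = n → (∀ v, G.degree v ≤ Δ) →
    (∀ v, (G.cliqueNumAt v : ℝ) + R ≤ (L v).card) → G.HasLongLists L → G.ListColorable L := by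
  induction n using Nat.strong_induction_on with
  | _ n ih =>
    intro V _ G _ L hn hΔ hω hL
    classical
    by_contra hnot
    refine not_isListCritical hΔ hR hRΔ hω hL ⟨hnot, fun H hH => ?_⟩
    obtain ⟨v₀, hv₀⟩ := hH
    set s : Set V := {v | v ∉ H} with hs
    have hcard : Fintype.card s < n := by
      rw [← hn]
      exact Fintype.card_subtype_lt (x := v₀) (by simpa [hs] using hv₀)
    have hdeg : ∀ v : s, (G.induce s).degree v ≤ G.degree v := G.degree_induce_le s
    have hcl : ∀ v : s, ((G.induce s).cliqueNumAt v : ℝ) ≤ G.cliqueNumAt v := fun v =>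
      Nat.cast_le.2 (G.cliqueNumAt_induce_le s v)
    obtain ⟨φ, hφ⟩ := ih _ hcard s (G.induce s) (fun v => L v) rfl
      (fun v => (hdeg v).trans (hΔ v)) (fun v => by linarith [hω v, hcl v]) (fun v => by
        have h1 := hL v
        have h2 : ((G.induce s).degree v : ℝ) ≤ G.degree v := Nat.cast_le.2 (hdeg v)
        have h3 := hcl v
        linarith)
    have hC : Nonempty C := by
      have h1 := hω v₀
      have h2 : (0 : ℝ) ≤ G.cliqueNumAt v₀ := Nat.cast_nonneg _
      have h3 : (0 : ℝ) < (L v₀).card := by linarith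
      obtain ⟨c, -⟩ := Finset.card_pos.1 (Nat.cast_pos.1 h3)
      exact ⟨c⟩
    refine ⟨fun v => if hv : v ∈ s then φ ⟨v, hv⟩ else Classical.arbitrary C, fun v hv => ?_,
      fun u hu v hv huv => ?_⟩
    · have hv' : v ∈ s := by simpa [hs] using hv
      simpa [hv'] using hφ ⟨v, hv'⟩
    · have hu' : u ∈ s := by simpa [hs] using hu
      have hv' : v ∈ s := by simpa [hs] using hv
      simp only [hu', hv', dif_pos]
      exact φ.valid (v := ⟨u, hu'⟩) (w := ⟨v, hv'⟩) huv

/-- Only the colors that occur in the lists matter. -/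
theorem listColorable_of_subtype {V C : Type*} [DecidableEq C] {G : SimpleGraph V} {L : V → Finset C} {U : Finset C}
    (h : G.ListColorable fun v => (L v).subtype (· ∈ U)) : G.ListColorable L := by
  obtain ⟨φ, hφ⟩ := h
  refine ⟨Coloring.mk (fun v => (φ v : C)) fun {u v} huv heq => φ.valid huv (Subtype.ext heq),
    fun v => ?_⟩
  exact Finset.mem_subtype.1 (hφ v)

theorem eventually_le_exp_log_pow :
    ∀ᶠ Δ : ℕ in Filter.atTop, (1000000 : ℝ) ≤ Real.log Δ ^ 10 ∧
      8 * ((Δ : ℝ) + 1) ^ 5 ≤ Real.exp (Real.log Δ ^ 10 / 10 ^ 12) := by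
  have h1 : Filter.Tendsto (fun Δ : ℕ => Real.log (Δ : ℝ)) Filter.atTop Filter.atTop :=
    Real.tendsto_log_atTop.comp tendsto_natCast_atTop_atTop
  filter_upwards [h1.eventually_ge_atTop 100, Filter.eventually_ge_atTop 256] with Δ hlog hΔ
  have hΔ' : (256 : ℝ) ≤ Δ := by exact_mod_cast hΔ
  have h9 : (100 : ℝ) ^ 9 ≤ Real.log Δ ^ 9 := pow_le_pow_left₀ (by norm_num) hlog 9
  have h10 : (100 : ℝ) ^ 9 * Real.log Δ ≤ Real.log Δ ^ 10 := by
    rw [pow_succ _ 9]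
    exact mul_le_mul_of_nonneg_right h9 (by linarith)
  refine ⟨by linarith, ?_⟩
  -- For log Δ ≥ 100 the right side is at least 10^6 · log Δ. A factor 6 suffices: exp(6 log Δ) =
  -- Δ^6 absorbs 8(2Δ)^5 = 256 Δ^5.
  have h2 : 6 * Real.log Δ ≤ Real.log Δ ^ 10 / 10 ^ 12 := by linarith
  refine le_trans ?_ (Real.exp_le_exp.2 h2)
  have h3 : Real.exp (6 * Real.log Δ) = (Δ : ℝ) ^ 6 := by
    rw [← Real.exp_log (show (0 : ℝ) < Δ by linarith), ← Real.exp_nat_mul, Real.log_exp]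
    norm_num
  rw [h3]
  calc 8 * ((Δ : ℝ) + 1) ^ 5 ≤ 8 * (2 * Δ) ^ 5 := by gcongr; linarith
    _ = 256 * (Δ : ℝ) ^ 5 := by ring
    _ ≤ Δ * (Δ : ℝ) ^ 5 := by gcongr
    _ = (Δ : ℝ) ^ 6 := by ring

theorem listColorable_of_log {Δ : ℕ}
    (hΔ0 : (1000000 : ℝ) ≤ Real.log Δ ^ 10 ∧
      8 * ((Δ : ℝ) + 1) ^ 5 ≤ Real.exp (Real.log Δ ^ 10 / 10 ^ 12))
    {V C : Type*} [Fintype V] (G : SimpleGraph V) [DecidableRel G.Adj]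
    (L : V → Finset C) (hΔ : G.maxDegree ≤ Δ)
    (hω : ∀ v, (G.cliqueNumAt v : ℝ) + Real.log (Δ : ℝ) ^ 10 ≤ ((L v).card : ℝ))
    (hL : G.HasLongLists L) : G.ListColorable L := by
  classical
  -- The color type may be infinite, whereas the product space needs finitely many colors.
  let U : Finset C := Finset.univ.biUnion L
  have hcard : ∀ v, ((L v).subtype (· ∈ U)).card = (L v).card := by
    intro v
    rw [Finset.card_subtype, Finset.filter_true_of_mem]
    exact fun c hc => Finset.mem_biUnion.2 ⟨v, Finset.mem_univ v, hc⟩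
  refine listColorable_of_subtype (U := U) ?_
  refine listColorable_of_long_lists (C := U) hΔ0.1 hΔ0.2 _ V G _ rfl
    (fun v => (G.degree_le_maxDegree v).trans hΔ) (fun v => ?_) (fun v => ?_)
  · rw [hcard]
    exact hω v
  · rw [hcard]
    exact hL v

end SimpleGraph

theorem mainTheorem1 :
    (∃ Δ₀ : ℕ, ∀ (V : Type*) (C : Type*) [Fintype V] (G : SimpleGraph V) [DecidableRel G.Adj]
      (L : V → Finset C), Δ₀ ≤ G.maxDegree →
      (∀ v, (G.cliqueNumAt v : ℝ) + Real.log (G.maxDegree : ℝ) ^ 10 ≤ ((L v).card : ℝ)) →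
      (∀ v, (1 - 1 / 330 : ℝ) * ((G.degree v : ℝ) + 1) + (1 / 330 : ℝ) * (G.cliqueNumAt v : ℝ)
        ≤ ((L v).card : ℝ)) →
      G.ListColorable L) ∧
    (∃ Δ₀ : ℕ, ∀ Δ : ℕ, Δ₀ ≤ Δ →
      ∀ (V : Type*) (C : Type*) [Fintype V] (G : SimpleGraph V) [DecidableRel G.Adj]
      (L : V → Finset C), G.maxDegree ≤ Δ →
      (∀ v, (G.cliqueNumAt v : ℝ) + Real.log (Δ : ℝ) ^ 10 ≤ ((L v).card : ℝ)) →
      (∀ v, (1 - 1 / 330 : ℝ) * ((G.degree v : ℝ) + 1) + (1 / 330 : ℝ) * (G.cliqueNumAt v : ℝ)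
        ≤ ((L v).card : ℝ)) →
      G.ListColorable L) := by
  obtain ⟨Δ₀, h⟩ := Filter.eventually_atTop.1 SimpleGraph.eventually_le_exp_log_pow
  -- The first form is the inductive one with `Δ` equal to the maximum degree.
  exact ⟨⟨Δ₀, fun V C _ G _ L hΔ hω hL =>
      SimpleGraph.listColorable_of_log (h _ hΔ) G L le_rfl hω hL⟩,
    ⟨Δ₀, fun Δ hΔ V C _ G _ L hG hω hL =>
      SimpleGraph.listColorable_of_log (h Δ hΔ) G L hG hω hL⟩⟩
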